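/- All Hilbert spaces are finite-dimensional, $|A|$ is the dimension of $A$, and $\log$ is the binary logarithm. Let $p$ be a probability distribution on a finite alphabet $\mathcal X$ and let $|\psi_x\rangle^{BR}$, $x\in\mathcal X$, be unit vectors in $B\otimes R$. For $n\ge 1$ and $x^n=x_1\cdots x_n$ put $p(x^n)=\prod_i p(x_i)$, $|\psi_{x^n}\rangle=\bigotimes_i|\psi_{x_i}\rangle$, and $$\omega^{X^nX'^nB^nR^n}=\sum_{x^n\in\mathcal X^n}p(x^n)\,|x^n\rangle\langle x^n|^{X^n}\otimes|x^n\rangle\langle x^n|^{X'^n}\otimes|\psi_{x^n}\rangle\langle\psi_{x^n}|^{B^nR^n},$$ where $X$, $X'$ have dimension $|X|=|\mathcal X|$. For $K\ge1$ let $\Phi_K$ be the maximally entangled state of two $K$-dimensional systems. An entanglement-assisted code of block length $n$ consists of completely positive trace-preserving maps $$\mathcal E_X:X^n\to C_X,\qquad \mathcal E_B:B^nB_0\to C_BB_0',\qquad \mathcal D:C_XC_BD_0\to\hat X^n\hat B^nD_0',$$ where $B_0,D_0$ have dimension $K\ge 1$ and $B_0',D_0'$ have dimension $L\ge 1$. It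 has error $\epsilon\geq 0$ if $$F\Bigl(\omega^{X^nX'^nB^nR^n}\otimes\Phi_L^{B_0'D_0'},\ \bigl(\mathcal D\circ(\mathcal E_X\otimes\mathcal E_B\otimes\mathrm{id}_{D_0})\otimes\mathrm{id}_{X'^nR^n}\bigr)\,\omega^{X^nX'^nB^nR^n}\otimes\Phi_K^{B_0D_0}\Bigr)\ \ge\ 1-\epsilon,$$ where $F(\rho,\sigma)=\operatorname{Tr}\sqrt{\rho^{1/2}\sigma\rho^{1/2}}$. **Lemma (decoupling condition).** Consider such a code of block length $n$ and error $\epsilon$, with $0\le\epsilon\le 1/6$. Let $U_X:X^n\to C_XW_X$, $U_B:B^nB_0\to C_BB_0'W_B$ and $V:C_XC_BD_0\to\hat X^n\hat B^nD_0'W_D$ be any Stinespring isometries of $\mathcal E_X$, $\mathcal E_B$ and $\mathcal D$ (that is, $\mathcal E_X(\rho)=\operatorname{Tr}_{W_X}U_X\rho U_X^\dagger$, and likewise for the other two), and let $\xi$ be the state on $X'^n\hat X^n\hat B^nB_0'D_0'W_XW_BW_DR^n$ obtained by applying first $U_X\otimes U_B$ and then $V$ to $\omega^{X^nX'^nB^nR^n}\otimes\Phi_K^{B_0D_0}$.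 Then $$I(W_XW_BW_DB_0'D_0':\hat X^n\hat B^nR^n\,|\,X'^n)_\xi\ \le\ n\,\delta(n,\epsilon),\qquad \delta(n,\epsilon)=4\sqrt{6\epsilon}\,\log(|X||B|)+\tfrac2n\,h(\sqrt{6\epsilon}),$$ where $h(t)=-t\log t-(1-t)\log(1-t)$ for $0\le t\le 1$ (with $0\log 0=0$), $I(A:B|C)_\xi=S(AC)_\xi+S(BC)_\xi-S(ABC)_\xi-S(C)_\xi$, and $S(\rho)=-\operatorname{Tr}\rho\log\rho$. -/

import Mathlib

namespace CQSW

noncomputable section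

open scoped Kronecker ComplexOrder

/-- Operators on the finite-dimensional Hilbert space `ℂ^A`. The register formed by two systems
`A` and `B` is indexed by `A × B`, and `n` copies of `A` by `Fin n → A`. -/
abbrev Op (A : Type*) := Matrix A A ℂ

section General

variable {A B C A' B' W : Type*}

/-- The rank-one operator `|v⟩⟨v|`. -/
def ketbra (v : A → ℂ) : Op A := Matrix.vecMulVec v (star v)

/-- Partial trace over the second factor. -/
def traceRight [Fintype B] (ρ : Op (A × B)) : Op A :=
  Matrix.of fun a a' => ∑ b, ρ (a, b) (a', b)

/-- `Φ ⊗ id_C`: apply `Φ` to each of the blocks of `ρ` that are indexed by a pair of basis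
elements of `C`. -/
def tensorId (C : Type*) (Φ : Op A →ₗ[ℂ] Op A') : Op (A × C) →ₗ[ℂ] Op (A' × C) where
  toFun ρ := Matrix.of fun i j => Φ (Matrix.of fun a a' => ρ (a, i.2) (a', j.2)) i.1 j.1
  map_add' ρ σ := by
    ext i j
    exact congrFun (congrFun (Φ.map_add (Matrix.of fun a a' => ρ (a, i.2) (a', j.2))
      (Matrix.of fun a a' => σ (a, i.2) (a', j.2))) i.1) j.1
  map_smul' c ρ := by
    ext i j
    exact congrFun (congrFun
      (Φ.map_smul c (Matrix.of fun a a' => ρ (a, i.2) (a', j.2))) i.1) j.1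

/-- `id_C ⊗ Φ`. -/
def idTensor (C : Type*) (Φ : Op A →ₗ[ℂ] Op A') : Op (C × A) →ₗ[ℂ] Op (C × A') where
  toFun ρ := Matrix.of fun i j => Φ (Matrix.of fun a a' => ρ (i.1, a) (j.1, a')) i.2 j.2
  map_add' ρ σ := by
    ext i j
    exact congrFun (congrFun (Φ.map_add (Matrix.of fun a a' => ρ (i.1, a) (j.1, a'))
      (Matrix.of fun a a' => σ (i.1, a) (j.1, a'))) i.2) j.2
  map_smul' c ρ := by
    ext i j
    exact congrFun (congrFun
      (Φ.map_smul c (Matrix.of fun a a' => ρ (i.1, a) (j.1, a'))) i.2) j.2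

/-- The tensor product `Φ ⊗ Ψ = (Φ ⊗ id) ∘ (id ⊗ Ψ)`. -/
def tensorMap (Φ : Op A →ₗ[ℂ] Op A') (Ψ : Op B →ₗ[ℂ] Op B') :
    Op (A × B) →ₗ[ℂ] Op (A' × B') :=
  tensorId B' Φ ∘ₗ idTensor A Ψ

/-- A quantum operation from `A` to `A'`: a completely positive and trace preserving linear map. -/
structure Channel (A A' : Type*) [Fintype A] [Fintype A'] where
  map : Op A →ₗ[ℂ] Op A'
  completelyPositive : ∀ (k : ℕ) (ρ : Op (A × Fin k)),
    ρ.PosSemidef → (tensorId (Fin k) map ρ).PosSemidef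
  tracePreserving : ∀ ρ : Op A, (map ρ).trace = ρ.trace

/-- The map `ρ ↦ U ρ U†`. -/
def conjMap [Fintype A] (U : Matrix A' A ℂ) : Op A →ₗ[ℂ] Op A' where
  toFun ρ := U * ρ * U.conjTranspose
  map_add' ρ σ := by rw [Matrix.mul_add, Matrix.add_mul]
  map_smul' c ρ := by simp

/-- `U : A → A' W` is a Stinespring dilation of the channel `E : A → A'` with environment `W`:
`U` is an isometry and `E(ρ) = Tr_W (U ρ U†)`. -/
def IsStinespring [Fintype A] [Fintype A'] [Fintype W] [DecidableEq A]
    (E : Channel A A') (U : Matrix (A' × W) A ℂ) : Prop :=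
  U.conjTranspose * U = 1 ∧ ∀ ρ : Op A, E.map ρ = traceRight (conjMap U ρ)

/-- The positive square root of a positive semidefinite operator, by functional calculus. -/
def opSqrt [Fintype A] [DecidableEq A] (ρ : Op A) : Op A := cfc Real.sqrt ρ

/-- The fidelity `F(ρ, σ) = Tr √(ρ^{1/2} σ ρ^{1/2})`. -/
def fidelity [Fintype A] [DecidableEq A] (ρ σ : Op A) : ℝ :=
  (opSqrt (opSqrt ρ * σ * opSqrt ρ)).trace.re

/-- The von Neumann entropy `S(ρ) = -Tr ρ log ρ`, with the binary logarithm. -/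
def entropy [Fintype A] [DecidableEq A] (ρ : Op A) : ℝ :=
  (cfc (fun t : ℝ => -(t * Real.logb 2 t)) ρ).trace.re

/-- The conditional mutual information
`I(A : B | C) = S(AC) + S(BC) - S(ABC) - S(C)` of a state on `A B C`. -/
def condMutualInfo [Fintype A] [Fintype B] [Fintype C]
    [DecidableEq A] [DecidableEq B] [DecidableEq C] (ρ : Op (A × B × C)) : ℝ :=
  let ρAC : Op (A × C) :=
    traceRight (B := B) (ρ.submatrix (fun ((a, c), b) => (a, b, c)) (fun ((a, c), b) => (a, b, c)))
  let ρBC : Op (B × C) :=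
    traceRight (B := A) (ρ.submatrix (fun ((b, c), a) => (a, b, c)) (fun ((b, c), a) => (a, b, c)))
  let ρC : Op C :=
    traceRight (B := A × B)
      (ρ.submatrix (fun (c, (a, b)) => (a, b, c)) (fun (c, (a, b)) => (a, b, c)))
  entropy ρAC + entropy ρBC - entropy ρ - entropy ρC

end General

/-- The maximally entangled state `Φ_K` of two `K`-dimensional systems, the projector onto
`K^{-1/2} ∑_i |i⟩|i⟩`. -/
def maxEntangled (K : ℕ) : Op (Fin K × Fin K) :=
  ketbra fun i => if i.1 = i.2 then ((1 / Real.sqrt K : ℝ) : ℂ) else 0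

/-- The binary entropy, with the binary logarithm. -/
def binaryEntropy (t : ℝ) : ℝ := -t * Real.logb 2 t - (1 - t) * Real.logb 2 (1 - t)

/-- `δ(n, ε) = 4 √(6ε) log(|X| |B|) + (2/n) h(√(6ε))`, for `dX = |X|` and `dB = |B|`. -/
def delta (dX dB n : ℕ) (ε : ℝ) : ℝ :=
  4 * Real.sqrt (6 * ε) * Real.logb 2 ((dX : ℝ) * (dB : ℝ))
    + (2 / (n : ℝ)) * binaryEntropy (Real.sqrt (6 * ε))

/-- A classical-quantum source: a probability distribution `p` on the finite alphabet `X`,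
and for each letter `x` a unit vector `ψ_x` in `B ⊗ R`. -/
structure Source (X B R : Type*) [Fintype X] [Fintype B] [Fintype R] where
  p : X → ℝ
  p_nonneg : ∀ x, 0 ≤ p x
  p_sum : ∑ x, p x = 1
  ψ : X → B × R → ℂ
  ψ_norm : ∀ x, ∑ i, ‖ψ x i‖ ^ 2 = 1

namespace Source

variable {X B R : Type*} [Fintype X] [Fintype B] [Fintype R] (s : Source X B R)

/-- `p(x^n) = p(x_1) ⋯ p(x_n)`. -/
def pn (n : ℕ) (x : Fin n → X) : ℝ := ∏ i, s.p (x i)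

/-- `ψ_{x^n} = ψ_{x_1} ⊗ ⋯ ⊗ ψ_{x_n}`, as a vector in `B^n ⊗ R^n`. -/
def ψn (n : ℕ) (x : Fin n → X) : (Fin n → B) × (Fin n → R) → ℂ :=
  fun br => ∏ i, s.ψ (x i) (br.1 i, br.2 i)

/-- The extended source state
`ω^{X^n X'^n B^n R^n} = ∑ p(x^n) |x^n⟩⟨x^n| ⊗ |x^n⟩⟨x^n| ⊗ |ψ_{x^n}⟩⟨ψ_{x^n}|`. -/
def omega [DecidableEq X] (n : ℕ) :
    Op (((Fin n → X) × (Fin n → X)) × ((Fin n → B) × (Fin n → R))) :=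
  ∑ x : Fin n → X, (s.pn n x : ℂ) •
    ((Matrix.single x x (1 : ℂ) ⊗ₖ Matrix.single x x (1 : ℂ)) ⊗ₖ ketbra (s.ψn n x))

/-- `ω^{X^n X'^n B^n R^n} ⊗ Φ_K^{B₀ D₀}`, the registers in the order
`X^n`, `B^n B₀`, `D₀ X'^n R^n`. -/
def inputState [DecidableEq X] (n K : ℕ) :
    Op ((Fin n → X) × (((Fin n → B) × Fin K) × (Fin K × ((Fin n → X) × (Fin n → R))))) :=
  (s.omega n ⊗ₖ maxEntangled K).submatrix
    (fun (x, ((b, b₀), (d₀, (x', r)))) => (((x, x'), (b, r)), (b₀, d₀)))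
    (fun (x, ((b, b₀), (d₀, (x', r)))) => (((x, x'), (b, r)), (b₀, d₀)))

end Source

/-- An entanglement-assisted code of block length `n`, with compressed systems `CX` and `CB`,
input entanglement registers `B₀`, `D₀` of dimension `K` and output entanglement registers
`B₀'`, `D₀'` of dimension `L`: the encoders `X^n → CX` and `B^n B₀ → CB B₀'`, and the decoder
`CX CB D₀ → X̂^n B̂^n D₀'`. -/
structure EACode (X B CX CB : Type*) [Fintype X] [Fintype B] [Fintype CX] [Fintype CB]
    (n K L : ℕ) where
  encX : Channel (Fin n → X) CX
  encB : Channel ((Fin n → B) × Fin K) (CB × Fin L)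
  dec : Channel ((CX × CB) × Fin K) (((Fin n → X) × (Fin n → B)) × Fin L)

namespace EACode

variable {X B R CX CB : Type*} [Fintype X] [Fintype B] [Fintype R] [Fintype CX] [Fintype CB]
  {n K L : ℕ}

/-- The state `(D ∘ (E_X ⊗ E_B ⊗ id_{D₀}) ⊗ id_{X'^n R^n}) (ω^{X^n X'^n B^n R^n} ⊗ Φ_K^{B₀ D₀})`,
the registers in the order `X̂^n X'^n B̂^n R^n`, `B₀' D₀'`. -/
def outputState [DecidableEq X] (code : EACode X B CX CB n K L) (s : Source X B R) :
    Op ((((Fin n → X) × (Fin n → X)) × ((Fin n → B) × (Fin n → R))) × (Fin L × Fin L)) :=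
  let encoded :
      Op (CX × ((CB × Fin L) × (Fin K × ((Fin n → X) × (Fin n → R))))) :=
    tensorMap code.encX.map (tensorMap code.encB.map LinearMap.id) (s.inputState n K)
  let received :
      Op (((CX × CB) × Fin K) × (Fin L × ((Fin n → X) × (Fin n → R)))) :=
    encoded.submatrix
      (fun (((cx, cb), d₀), (b₀', (x', r))) => (cx, ((cb, b₀'), (d₀, (x', r)))))
      (fun (((cx, cb), d₀), (b₀', (x', r))) => (cx, ((cb, b₀'), (d₀, (x', r)))))
  let decoded :
      Op ((((Fin n → X) × (Fin n → B)) × Fin L) × (Fin L × ((Fin n → X) × (Fin n → R)))) :=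
    tensorMap code.dec.map LinearMap.id received
  decoded.submatrix
    (fun (((x, x'), (b, r)), (b₀', d₀')) => (((x, b), d₀'), (b₀', (x', r))))
    (fun (((x, x'), (b, r)), (b₀', d₀')) => (((x, b), d₀'), (b₀', (x', r))))

set_option synthInstance.maxSize 1000 in
/-- The average fidelity of the code, the fidelity of `ω^{X^n X'^n B^n R^n} ⊗ Φ_L^{B₀' D₀'}` and
the output state. -/
def avgFidelity [DecidableEq X] [DecidableEq B] [DecidableEq R]
    (code : EACode X B CX CB n K L) (s : Source X B R) : ℝ :=
  fidelity (s.omega n ⊗ₖ maxEntangled L) (code.outputState s)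

end EACode

/-- The state `ξ` obtained from `ω^{X^n X'^n B^n R^n} ⊗ Φ_K^{B₀ D₀}` by the isometries
`U_X : X^n → CX W_X`, `U_B : B^n B₀ → CB B₀' W_B` and `V : CX CB D₀ → X̂^n B̂^n D₀' W_D`,
the registers in the order `W_X W_B W_D B₀' D₀'`, `X̂^n B̂^n R^n`, `X'^n`. -/
def finalState {X B R CX CB WX WB WD : Type*} [Fintype X] [Fintype B] [Fintype R]
    [Fintype CX] [Fintype CB] [DecidableEq X] {n K L : ℕ} (s : Source X B R)
    (UX : Matrix (CX × WX) (Fin n → X) ℂ)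
    (UB : Matrix ((CB × Fin L) × WB) ((Fin n → B) × Fin K) ℂ)
    (V : Matrix ((((Fin n → X) × (Fin n → B)) × Fin L) × WD) ((CX × CB) × Fin K) ℂ) :
    Op ((WX × WB × WD × Fin L × Fin L) × ((Fin n → X) × (Fin n → B) × (Fin n → R)) ×
      (Fin n → X)) :=
  let encoded :
      Op ((CX × WX) × (((CB × Fin L) × WB) × (Fin K × ((Fin n → X) × (Fin n → R))))) :=
    tensorMap (conjMap UX) (tensorMap (conjMap UB) LinearMap.id) (s.inputState n K)
  let received :
      Op (((CX × CB) × Fin K) × (WX × WB × Fin L × (Fin n → X) × (Fin n → R))) :=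
    encoded.submatrix
      (fun (((cx, cb), d₀), (wx, wb, b₀', x', r)) =>
        ((cx, wx), (((cb, b₀'), wb), (d₀, (x', r)))))
      (fun (((cx, cb), d₀), (wx, wb, b₀', x', r)) =>
        ((cx, wx), (((cb, b₀'), wb), (d₀, (x', r)))))
  let decoded :
      Op (((((Fin n → X) × (Fin n → B)) × Fin L) × WD) ×
        (WX × WB × Fin L × (Fin n → X) × (Fin n → R))) :=
    tensorMap (conjMap V) LinearMap.id received
  decoded.submatrix
    (fun ((wx, wb, wd, b₀', d₀'), (x, b, r), x') => ((((x, b), d₀'), wd), (wx, wb, b₀', x', r)))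
    (fun ((wx, wb, wd, b₀', d₀'), (x, b, r), x') => ((((x, b), d₀'), wd), (wx, wb, b₀', x', r)))

end

end CQSW

/-! The encoders and the decoder leave `X'ⁿ` untouched, and their dilations are isometries. Hence
`ξ` is a mixture, classical on `X'ⁿ`, of pure states, one for each source sequence `x`. For such a
state the four entropies of the conditional mutual information collapse to twice the average
entanglement entropy `∑ p(x) S(x)` between the environment side and `X̂ⁿB̂ⁿRⁿ`
(`condMutualInfo_classical_pure`).

Each conditional marginal on `X̂ⁿB̂ⁿRⁿ` is nearly pure. The ideal states `|x⟩|x⟩|ψ_x⟩|Φ_L⟩` are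
orthonormal and the output is diagonal on their span, so the fidelity of the code is exactly the
average of the square roots of the overlaps (`avgFidelity_eq`). Discarding `B₀'D₀'` only increases
the overlap (`codeOverlap_le`), so the marginals have average overlap at least `1 - 2ε ≥ 1 - √(6ε)`
with `|x⟩|ψ_x⟩`.

Their rank is at most `D = |X|ⁿ|B|²ⁿ`, whatever the dimension of `R`, because `Rⁿ` enters only
through the Schmidt decomposition of `ψ_x` (`rank_finalMatrix_le`). A quantum Fano inequality in
terms of rank, averaged over `x` (`sum_mul_entropy_le`), bounds the mean entropy by `h(t) + t log D`
with `t = √(6ε)`. Doubling this and using `log D ≤ 2n log(|X||B|)` gives the claim. -/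

namespace CQSW

noncomputable section

open scoped Kronecker ComplexOrder
open Polynomial Matrix

/-! ### Von Neumann entropy through the spectrum, and bounds from rank and overlap. -/

section Entropy

variable {m n ι : Type*} [Fintype m] [Fintype n] [DecidableEq m] [DecidableEq n]

/-- The function `t ↦ -t log t`, with the binary logarithm. -/
def negMulLogb (t : ℝ) : ℝ := -(t * Real.logb 2 t)

@[simp] lemma negMulLogb_zero : negMulLogb 0 = 0 := by simp [negMulLogb]

@[simp] lemma negMulLogb_one : negMulLogb 1 = 0 := by simp [negMulLogb]

lemma negMulLogb_mul {a b : ℝ} (ha : a ≠ 0) :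
    negMulLogb (a * b) = a * negMulLogb b + b * negMulLogb a := by
  rcases eq_or_ne b 0 with rfl | hb
  · simp
  · rw [negMulLogb, Real.logb_mul ha hb, negMulLogb, negMulLogb]
    ring

lemma entropy_eq_sum_eigenvalues {A : Op m} (hA : A.IsHermitian) :
    entropy A = ∑ i, negMulLogb (hA.eigenvalues i) := by
  have hs := (hA.charpoly_cfc_eq negMulLogb)
  have hroots : (cfc negMulLogb A).charpoly.roots =
      Multiset.map (fun i => ((negMulLogb (hA.eigenvalues i) : ℝ) : ℂ)) Finset.univ.val := by
    rw [hs, Polynomial.roots_prod]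
    · simp
    · simp [Finset.prod_ne_zero_iff, Polynomial.X_sub_C_ne_zero]
  change (cfc negMulLogb A).trace.re = _
  rw [Matrix.trace_eq_sum_roots_charpoly, hroots]
  simp

lemma entropy_eq_sum_roots {A : Op m} (hA : A.IsHermitian) :
    entropy A = (A.charpoly.roots.map fun z => negMulLogb z.re).sum := by
  rw [entropy_eq_sum_eigenvalues hA, hA.roots_charpoly_eq_eigenvalues]
  simp

/-- Entropy sees only the nonzero spectrum: the factors `X ^ a` and `X ^ b` add zero eigenvalues,
which contribute `0 log 0 = 0`. This compares operators on spaces of different dimension. -/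
lemma entropy_eq_of_charpoly {A : Op m} {B : Op n} (hA : A.IsHermitian) (hB : B.IsHermitian)
    {a b : ℕ} (h : X ^ a * A.charpoly = X ^ b * B.charpoly) : entropy A = entropy B := by
  rw [entropy_eq_sum_roots hA, entropy_eq_sum_roots hB]
  have h' := congrArg (fun q : ℂ[X] => (q.roots.map fun z => negMulLogb z.re).sum) h
  rw [roots_mul (mul_ne_zero (pow_ne_zero _ X_ne_zero) (charpoly_monic A).ne_zero),
    roots_mul (mul_ne_zero (pow_ne_zero _ X_ne_zero) (charpoly_monic B).ne_zero)] at h'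
  simpa [Multiset.map_nsmul, Multiset.sum_nsmul] using h'

lemma entropy_submatrix_equiv {A : Op m} (hA : A.IsHermitian) (e : n ≃ m) :
    entropy (A.submatrix e e) = entropy A := by
  refine entropy_eq_of_charpoly (a := 0) (b := 0) (hA.submatrix e) hA ?_
  have := charpoly_reindex e.symm A
  simp only [reindex_apply, Equiv.symm_symm] at this
  rw [this]

lemma entropy_transpose {A : Op m} (hA : A.IsHermitian) : entropy Aᵀ = entropy A :=
  entropy_eq_of_charpoly (a := 0) (b := 0) hA.transpose hA (by rw [charpoly_transpose])

/-- Schmidt decomposition: up to a transpose, these are the two marginals of the bipartite vector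
with coefficient matrix `M`. -/
lemma entropy_conjTranspose_mul_self (M : Matrix m n ℂ) :
    entropy (Mᴴ * M) = entropy (M * Mᴴ) :=
  entropy_eq_of_charpoly (isHermitian_conjTranspose_mul_self M)
    (isHermitian_mul_conjTranspose_self M) (charpoly_mul_comm' Mᴴ M)

lemma entropy_diagonal (d : m → ℝ) :
    entropy (diagonal fun i => (d i : ℂ)) = ∑ i, negMulLogb (d i) := by
  have hA : (diagonal fun i => (d i : ℂ)).IsHermitian :=
    isHermitian_diagonal_of_self_adjoint _ (by ext i; simp)
  rw [entropy_eq_sum_roots hA, charpoly_diagonal, Polynomial.roots_prod]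
  · simp
  · simp [Finset.prod_ne_zero_iff, Polynomial.X_sub_C_ne_zero]

lemma charpoly_blockDiagonal (M : n → Matrix m m ℂ) :
    (blockDiagonal M).charpoly = ∏ k, (M k).charpoly := by
  unfold charpoly
  rw [← det_blockDiagonal]
  congr 1
  ext ⟨i, k⟩ ⟨j, l⟩
  simp only [charmatrix_apply, blockDiagonal_apply, diagonal_apply, Prod.mk.injEq]
  by_cases hkl : k = l <;> simp [hkl]

lemma entropy_blockDiagonal {M : n → Op m} (hM : ∀ k, (M k).IsHermitian) :
    entropy (blockDiagonal M) = ∑ k, entropy (M k) := by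
  have hB : (blockDiagonal M).IsHermitian := by
    rw [IsHermitian, blockDiagonal_conjTranspose]
    congr 1
    funext k
    exact hM k
  rw [entropy_eq_sum_roots hB, charpoly_blockDiagonal, Polynomial.roots_prod]
  · rw [Multiset.map_bind, Multiset.sum_bind]
    simp_rw [entropy_eq_sum_roots (hM _)]
    rfl
  · exact Finset.prod_ne_zero_iff.2 fun k _ => (charpoly_monic _).ne_zero

/-- The extra term `negMulLogb c`, summed over the blocks of a classical-quantum state, gives the
Shannon entropy of the classical register. -/
lemma entropy_smul {A : Op m} (hA : A.IsHermitian) (htr : A.trace = 1) (c : ℝ) :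
    entropy ((c : ℂ) • A) = c * entropy A + negMulLogb c := by
  rcases eq_or_ne c 0 with rfl | hc
  · have := entropy_diagonal (fun _ : m => (0 : ℝ))
    simpa using this
  have hcA : ((c : ℂ) • A).IsHermitian := by
    rw [IsHermitian, conjTranspose_smul, hA]; simp
  have hchar : ((c : ℂ) • A).charpoly =
      (diagonal fun i => ((c * hA.eigenvalues i : ℝ) : ℂ)).charpoly := by
    conv_lhs => rw [hA.spectral_theorem, ← map_smul, Unitary.conjStarAlgAut_apply,
      charpoly_mul_comm, ← mul_assoc]
    simp only [Unitary.coe_star_mul_self, one_mul]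
    congr 1
    ext i j
    by_cases hij : i = j <;> simp [hij]
  have hd : (diagonal fun i => ((c * hA.eigenvalues i : ℝ) : ℂ)).IsHermitian :=
    isHermitian_diagonal_of_self_adjoint _ (by ext i; simp)
  rw [entropy_eq_of_charpoly (a := 0) (b := 0) hcA hd (by rw [hchar]),
    entropy_diagonal, entropy_eq_sum_eigenvalues hA]
  have h1 : ∑ i, hA.eigenvalues i = 1 := by
    have := hA.trace_eq_sum_eigenvalues
    rw [htr] at this
    simpa using congrArg Complex.re this.symm
  simp_rw [negMulLogb_mul hc]
  rw [Finset.sum_add_distrib, ← Finset.mul_sum, ← Finset.sum_mul, h1, one_mul]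

lemma star_dotProduct_self {m : Type*} [Fintype m] (v : m → ℂ) :
    star v ⬝ᵥ v = ((∑ i, ‖v i‖ ^ 2 : ℝ) : ℂ) := by
  simp [dotProduct, ← Complex.normSq_eq_conj_mul_self, Complex.normSq_eq_norm_sq]

lemma ketbra_eq_mul_conjTranspose {m : Type*} (v : m → ℂ) :
    ketbra v = replicateCol Unit v * (replicateCol Unit v)ᴴ := by
  ext i j
  simp [ketbra, vecMulVec_apply, mul_apply]

lemma isHermitian_ketbra {m : Type*} (v : m → ℂ) : (ketbra v).IsHermitian := by
  rw [ketbra_eq_mul_conjTranspose]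
  exact isHermitian_mul_conjTranspose_self _

lemma trace_ketbra {m : Type*} [Fintype m] (v : m → ℂ) :
    (ketbra v).trace = ((∑ i, ‖v i‖ ^ 2 : ℝ) : ℂ) := by
  simp [ketbra, trace, vecMulVec_apply, Complex.mul_conj, Complex.normSq_eq_norm_sq]

lemma entropy_ketbra {v : m → ℂ} (hv : ∑ i, ‖v i‖ ^ 2 = 1) : entropy (ketbra v) = 0 := by
  rw [ketbra_eq_mul_conjTranspose, ← entropy_conjTranspose_mul_self]
  have h : (replicateCol Unit v)ᴴ * replicateCol Unit v = diagonal fun _ => ((1 : ℝ) : ℂ) := by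
    ext i j
    simp [mul_apply, ← Complex.normSq_eq_conj_mul_self, Complex.normSq_eq_norm_sq]
    exact_mod_cast hv
  rw [h, entropy_diagonal]
  simp

/-- Gibbs' inequality. -/
lemma sum_negMulLogb_le (t : Finset ι) {p q : ι → ℝ} (hp : ∀ i ∈ t, 0 < p i)
    (hq : ∀ i ∈ t, 0 < q i) (h : ∑ i ∈ t, q i ≤ ∑ i ∈ t, p i) :
    ∑ i ∈ t, negMulLogb (p i) ≤ ∑ i ∈ t, -(p i * Real.logb 2 (q i)) := by
  have hl : 0 < Real.log 2 := Real.log_pos one_lt_two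
  have key : ∀ i ∈ t, negMulLogb (p i) - -(p i * Real.logb 2 (q i)) ≤
      (q i - p i) / Real.log 2 := by
    intro i hi
    have h1 := Real.log_le_sub_one_of_pos (div_pos (hq i hi) (hp i hi))
    rw [Real.log_div (hq i hi).ne' (hp i hi).ne'] at h1
    have h2 : p i * (Real.log (q i) - Real.log (p i)) ≤ q i - p i := by
      have := mul_le_mul_of_nonneg_left h1 (hp i hi).le
      rwa [mul_sub (p i) (q i / p i), mul_one, mul_div_cancel₀ _ (hp i hi).ne'] at this
    rw [negMulLogb, Real.logb, Real.logb]
    calc _ = p i * (Real.log (q i) - Real.log (p i)) / Real.log 2 := by ring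
      _ ≤ _ := div_le_div_of_nonneg_right h2 hl.le
  have := Finset.sum_le_sum key
  rw [Finset.sum_sub_distrib, ← Finset.sum_div, Finset.sum_sub_distrib] at this
  have h3 : (∑ i ∈ t, q i - ∑ i ∈ t, p i) / Real.log 2 ≤ 0 :=
    div_nonpos_of_nonpos_of_nonneg (by linarith) hl.le
  linarith

/-- In an eigenbasis the expectation is a convex combination of the eigenvalues, so it cannot exceed
all of them. -/
lemma exists_re_dotProduct_le_eigenvalue {A : Op m} (hA : A.IsHermitian) {v : m → ℂ}
    (hv : ∑ i, ‖v i‖ ^ 2 = 1) : ∃ i, (star v ⬝ᵥ A *ᵥ v).re ≤ hA.eigenvalues i := by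
  set U : Matrix m m ℂ := (hA.eigenvectorUnitary : Matrix m m ℂ) with hU
  set c : m → ℂ := Uᴴ *ᵥ v with hc
  have hUU : U * Uᴴ = 1 := by
    rw [← star_eq_conjTranspose]; exact Unitary.coe_mul_star_self _
  have hnorm : ∑ i, ‖c i‖ ^ 2 = 1 := by
    have h1 : star c ⬝ᵥ c = star v ⬝ᵥ v := by
      rw [hc, star_mulVec, conjTranspose_conjTranspose, dotProduct_mulVec, vecMul_vecMul, hUU,
        vecMul_one]
    rw [star_dotProduct_self, star_dotProduct_self, hv] at h1
    exact_mod_cast h1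
  have hval : (star v ⬝ᵥ A *ᵥ v).re = ∑ i, hA.eigenvalues i * ‖c i‖ ^ 2 := by
    have h1 : star v ⬝ᵥ A *ᵥ v =
        star c ⬝ᵥ (diagonal fun i => (hA.eigenvalues i : ℂ)) *ᵥ c := by
      conv_lhs => rw [hA.spectral_theorem, Unitary.conjStarAlgAut_apply]
      rw [hc, star_mulVec, conjTranspose_conjTranspose, ← mulVec_mulVec, ← mulVec_mulVec,
        dotProduct_mulVec]
      rfl
    rw [h1]
    simp only [dotProduct, mulVec_diagonal, Complex.re_sum]
    refine Finset.sum_congr rfl fun i _ => ?_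
    have : star c i * (↑(hA.eigenvalues i) * c i) = ((hA.eigenvalues i * ‖c i‖ ^ 2 : ℝ) : ℂ) := by
      rw [mul_left_comm, Pi.star_apply, Complex.star_def, ← Complex.normSq_eq_conj_mul_self,
        Complex.normSq_eq_norm_sq]
      push_cast; rfl
    rw [this, Complex.ofReal_re]
  by_contra! hcon
  rw [hval] at hcon
  have hne : ∃ i, 0 < ‖c i‖ ^ 2 := by
    by_contra! h0
    have : ∑ i, ‖c i‖ ^ 2 ≤ 0 := Finset.sum_nonpos fun i _ => h0 i
    linarith
  obtain ⟨i, hi⟩ := hne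
  have : ∑ i, hA.eigenvalues i * ‖c i‖ ^ 2 <
      ∑ j, (∑ i, hA.eigenvalues i * ‖c i‖ ^ 2) * ‖c j‖ ^ 2 :=
    Finset.sum_lt_sum (fun j _ => mul_le_mul_of_nonneg_right (hcon j).le (by positivity))
      ⟨i, Finset.mem_univ i, mul_lt_mul_of_pos_right (hcon i) hi⟩
  rw [← Finset.mul_sum, hnorm, mul_one] at this
  exact lt_irrefl _ this

section Bounds

variable {A : Op m} {D : ℕ}

lemma sum_eigenvalues_eq_one (hA : A.PosSemidef) (htr : A.trace = 1) :
    ∑ i, hA.1.eigenvalues i = 1 := by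
  have := hA.1.trace_eq_sum_eigenvalues
  rw [htr] at this
  simpa using congrArg Complex.re this.symm

/-- Gibbs' inequality for the spectrum of a density operator. -/
lemma entropy_le_of_sum_le_one (hA : A.PosSemidef) (htr : A.trace = 1) {q : m → ℝ}
    (hq : ∀ i, 0 < q i)
    (h : ∑ i with hA.1.eigenvalues i ≠ 0, q i ≤ 1) :
    entropy A ≤ ∑ i, -(hA.1.eigenvalues i * Real.logb 2 (q i)) := by
  rw [entropy_eq_sum_eigenvalues hA.1]
  have h1 : ∀ f : m → ℝ, (∀ i, hA.1.eigenvalues i = 0 → f i = 0) →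
      ∑ i, f i = ∑ i with hA.1.eigenvalues i ≠ 0, f i := by
    intro f hf
    symm
    apply Finset.sum_filter_of_ne
    exact fun i _ hi h0 => hi (hf i h0)
  rw [h1 _ fun i hi => by rw [hi, negMulLogb_zero], h1 (fun i => -(_ * _)) fun i hi => by simp [hi]]
  refine sum_negMulLogb_le _ (fun i hi => ?_) (fun i _ => hq i) ?_
  · exact lt_of_le_of_ne (hA.eigenvalues_nonneg i) (Ne.symm (Finset.mem_filter.1 hi).2)
  · rw [← h1 _ fun i hi => hi, sum_eigenvalues_eq_one hA htr]
    exact h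

lemma card_eigenvalues_ne_zero_le (hA : A.PosSemidef) (hr : A.rank ≤ D) :
    (Finset.univ.filter fun i => hA.1.eigenvalues i ≠ 0).card ≤ D := by
  rw [← Fintype.card_subtype, ← hA.1.rank_eq_card_non_zero_eigs]
  exact hr

/-- Gibbs' inequality with the uniform weight `1 / D`, which needs total mass at most one only on
the support. -/
lemma entropy_le_logb_rank (hA : A.PosSemidef) (htr : A.trace = 1) (hr : A.rank ≤ D) (hD : 0 < D) :
    entropy A ≤ Real.logb 2 D := by
  have hD' : (0 : ℝ) < D := by exact_mod_cast hD
  refine (entropy_le_of_sum_le_one hA htr (q := fun _ => (D : ℝ)⁻¹) (fun _ => by positivity)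
    ?_).trans_eq ?_
  · rw [Finset.sum_const, nsmul_eq_mul, ← div_eq_mul_inv, div_le_one hD']
    exact_mod_cast card_eigenvalues_ne_zero_le hA hr
  · simp_rw [Real.logb_inv, mul_neg, neg_neg]
    rw [← Finset.sum_mul, sum_eigenvalues_eq_one hA htr, one_mul]

/-- The quantum Fano inequality, in a form that is affine in the overlap with a pure state. -/
lemma entropy_le_fano (hA : A.PosSemidef) (htr : A.trace = 1) (hr : A.rank ≤ D)
    (hD : 0 < D) {s : ℝ} (hs0 : 0 < s) (hs1 : s < 1) (hsD : s ≤ D * (1 - s))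
    {v : m → ℂ} (hv : ∑ i, ‖v i‖ ^ 2 = 1) :
    entropy A ≤ (star v ⬝ᵥ A *ᵥ v).re * -Real.logb 2 (1 - s) +
      (1 - (star v ⬝ᵥ A *ᵥ v).re) * (Real.logb 2 D - Real.logb 2 s) := by
  have hD' : (0 : ℝ) < D := by exact_mod_cast hD
  obtain ⟨i₀, hi₀⟩ := exists_re_dotProduct_le_eigenvalue hA.1 hv
  set f := (star v ⬝ᵥ A *ᵥ v).re
  have hc : s / D ≤ 1 - s := by rw [div_le_iff₀ hD']; linarith
  have hsd : 0 < s / D := by positivity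
  have hcard : ((Finset.univ.filter fun i => hA.1.eigenvalues i ≠ 0).card : ℝ) ≤ D := by
    exact_mod_cast card_eigenvalues_ne_zero_le hA hr
  -- The comparison weights put `1 - s` on the eigenvalue dominating the overlap and `s / D` on
  -- every other. With at most `D` nonzero eigenvalues the mass on the support is at most one,
  -- whether or not `i₀` lies in it.
  have h1 := entropy_le_of_sum_le_one hA htr (q := fun i => if i = i₀ then 1 - s else s / D)
    (fun i => by split_ifs <;> linarith) (by
      have e : ∀ i, (if i = i₀ then 1 - s else s / D) =
          s / D + if i = i₀ then 1 - s - s / D else 0 := by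
        intro i; split_ifs <;> ring
      simp_rw [e]
      rw [Finset.sum_add_distrib, Finset.sum_const, nsmul_eq_mul, Finset.sum_ite_eq']
      have h2 := mul_le_mul_of_nonneg_right hcard hsd.le
      rw [mul_div_cancel₀ _ hD'.ne'] at h2
      split_ifs <;> linarith)
  refine h1.trans ?_
  have e : ∀ i, -(hA.1.eigenvalues i * Real.logb 2 (if i = i₀ then 1 - s else s / D)) =
      hA.1.eigenvalues i * -Real.logb 2 (s / D) + if i = i₀ then
        hA.1.eigenvalues i * (Real.logb 2 (s / D) - Real.logb 2 (1 - s)) else 0 := by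
    intro i; split_ifs <;> ring
  simp_rw [e]
  rw [Finset.sum_add_distrib, ← Finset.sum_mul, sum_eigenvalues_eq_one hA htr,
    Finset.sum_ite_eq']
  simp only [Finset.mem_univ, if_true]
  -- By `hsD` the coefficient of the eigenvalue at `i₀` is nonpositive, so that eigenvalue may be
  -- replaced by the smaller overlap.
  have hlog : Real.logb 2 (s / D) ≤ Real.logb 2 (1 - s) :=
    Real.logb_le_logb_of_le one_lt_two hsd hc
  rw [Real.logb_div hs0.ne' hD'.ne'] at *
  nlinarith

/-- Some eigenvalue is at least one; as the trace is one, all others vanish. -/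
lemma entropy_nonpos_of_overlap_eq_one (hA : A.PosSemidef) (htr : A.trace = 1)
    {v : m → ℂ} (hv : ∑ i, ‖v i‖ ^ 2 = 1)
    (h : 1 ≤ (star v ⬝ᵥ A *ᵥ v).re) : entropy A ≤ 0 := by
  obtain ⟨i₀, hi₀⟩ := exists_re_dotProduct_le_eigenvalue hA.1 hv
  rw [entropy_eq_sum_eigenvalues hA.1]
  refine Finset.sum_nonpos fun i _ => ?_
  have hsum := sum_eigenvalues_eq_one hA htr
  by_cases hi : i = i₀
  · rw [hi]
    have : 0 ≤ Real.logb 2 (hA.1.eigenvalues i₀) := Real.logb_nonneg one_lt_two (by linarith)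
    have h2 := mul_nonneg (hA.eigenvalues_nonneg i₀) this
    rw [negMulLogb]; linarith
  · have h2 : hA.1.eigenvalues i + hA.1.eigenvalues i₀ ≤ 1 := by
      rw [← hsum, ← Finset.sum_pair hi]
      exact Finset.sum_le_sum_of_subset_of_nonneg (Finset.subset_univ _)
        fun j _ _ => hA.eigenvalues_nonneg j
    have h0 : hA.1.eigenvalues i = 0 := le_antisymm (by linarith) (hA.eigenvalues_nonneg i)
    rw [h0, negMulLogb_zero]

end Bounds

/-- This covers the range of `s` where the Fano weights have the wrong order and the rank bound
already suffices: `(1 - s) log D ≤ (1 - s)(log s - log (1 - s))`, which is `h(s) + log s ≤ h(s)`. -/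
lemma logb_le_binaryEntropy_add {s D : ℝ} (hD : 1 ≤ D) (hs1 : s ≤ 1)
    (hsD : D * (1 - s) ≤ s) : Real.logb 2 D ≤ binaryEntropy s + s * Real.logb 2 D := by
  rcases hs1.eq_or_lt with rfl | hs
  · simp [binaryEntropy]
  have hs0 : 0 < s := lt_of_lt_of_le (mul_pos (by linarith) (by linarith)) hsD
  have h1 : Real.logb 2 D + Real.logb 2 (1 - s) ≤ Real.logb 2 s := by
    rw [← Real.logb_mul (by linarith) (by linarith)]
    exact Real.logb_le_logb_of_le one_lt_two (mul_pos (by linarith) (by linarith)) hsD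
  have h2 : Real.logb 2 s ≤ 0 := Real.logb_nonpos one_lt_two hs0.le hs1
  have h3 := mul_le_mul_of_nonneg_left h1 (by linarith : 0 ≤ 1 - s)
  unfold binaryEntropy
  nlinarith

end Entropy

/-! ### Square roots and fidelity for operators diagonal in an orthonormal family. -/

section Fidelity

variable {m ι : Type*} [Fintype m] [DecidableEq m] [Fintype ι] [DecidableEq ι]

/-- The function `√(t * t)` is the identity on a nonnegative spectrum. Later roots are found by
exhibiting a positive operator with the right square. -/
lemma opSqrt_mul_self {S : Op m} (hS : S.PosSemidef) : opSqrt (S * S) = S := by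
  have hsa : IsSelfAdjoint S := hS.1
  have h2 : S * S = cfc (fun t : ℝ => t * t) S := by
    rw [cfc_mul (fun t : ℝ => t) (fun t : ℝ => t) S, cfc_id' ℝ S]
  rw [opSqrt, h2, ← cfc_comp' Real.sqrt (fun t : ℝ => t * t) S]
  conv_rhs => rw [← cfc_id' ℝ S]
  refine cfc_congr fun t ht => ?_
  rw [hS.1.spectrum_real_eq_range_eigenvalues] at ht
  obtain ⟨i, rfl⟩ := ht
  exact Real.sqrt_mul_self (hS.eigenvalues_nonneg i)

lemma opSqrt_isometry_conj_diagonal {V : Matrix m ι ℂ} (hV : Vᴴ * V = 1) {d : ι → ℝ}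
    (hd : ∀ i, 0 ≤ d i) :
    opSqrt (V * diagonal (fun i => (d i : ℂ)) * Vᴴ) =
      V * diagonal (fun i => (Real.sqrt (d i) : ℂ)) * Vᴴ := by
  have hpos : (V * diagonal (fun i => (Real.sqrt (d i) : ℂ)) * Vᴴ).PosSemidef :=
    (PosSemidef.diagonal fun i => by simp).mul_mul_conjTranspose_same V
  rw [← opSqrt_mul_self hpos]
  congr 1
  calc V * diagonal (fun i => (d i : ℂ)) * Vᴴ
      = V * (diagonal (fun i => (Real.sqrt (d i) : ℂ)) * (Vᴴ * V) *
          diagonal (fun i => (Real.sqrt (d i) : ℂ))) * Vᴴ := by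
        rw [hV, mul_one, diagonal_mul_diagonal]
        congr 3
        funext i
        rw [← Complex.ofReal_mul, Real.mul_self_sqrt (hd i)]
    _ = _ := by simp only [Matrix.mul_assoc]

/-- The fidelity with a state that is diagonal in an orthonormal family, when the other state is
diagonal on the span of the family. -/
lemma fidelity_isometry_conj_diagonal {V : Matrix m ι ℂ} (hV : Vᴴ * V = 1) {p g : ι → ℝ}
    (hp : ∀ i, 0 ≤ p i) (hg : ∀ i, 0 ≤ g i) {σ : Op m}
    (hσ : Vᴴ * σ * V = diagonal fun i => ((p i * g i : ℝ) : ℂ)) :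
    fidelity (V * diagonal (fun i => (p i : ℂ)) * Vᴴ) σ = ∑ i, p i * Real.sqrt (g i) := by
  -- Only the compression of `σ` to the span of the family enters the product.
  have h1 : V * diagonal (fun i => (Real.sqrt (p i) : ℂ)) * Vᴴ * σ *
      (V * diagonal (fun i => (Real.sqrt (p i) : ℂ)) * Vᴴ) =
      V * diagonal (fun i => ((p i ^ 2 * g i : ℝ) : ℂ)) * Vᴴ := by
    calc _ = V * (diagonal (fun i => (Real.sqrt (p i) : ℂ)) * (Vᴴ * σ * V) *
          diagonal (fun i => (Real.sqrt (p i) : ℂ))) * Vᴴ := by simp only [Matrix.mul_assoc]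
      _ = _ := by
        rw [hσ, diagonal_mul_diagonal, diagonal_mul_diagonal]
        congr 3
        funext i
        rw [← Complex.ofReal_mul, ← Complex.ofReal_mul]
        congr 1
        calc _ = (Real.sqrt (p i) * Real.sqrt (p i)) * (p i * g i) := by ring
          _ = _ := by rw [Real.mul_self_sqrt (hp i)]; ring
  rw [fidelity, opSqrt_isometry_conj_diagonal hV hp, h1, opSqrt_isometry_conj_diagonal hV
    fun i => mul_nonneg (sq_nonneg _) (hg i), trace_mul_cycle, hV, one_mul, trace_diagonal]
  simp only [Complex.re_sum, Complex.ofReal_re]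
  refine Finset.sum_congr rfl fun i _ => ?_
  rw [Real.sqrt_mul (sq_nonneg _), Real.sqrt_sq (hp i)]

lemma sum_smul_ketbra {m : Type*} (p : ι → ℂ) (v : ι → m → ℂ) :
    ∑ i, p i • ketbra (v i) =
      (of fun a i => v i a) * diagonal p * (of fun a i => v i a : Matrix m ι ℂ)ᴴ := by
  ext a b
  rw [Matrix.mul_apply]
  simp only [Matrix.sum_apply, Matrix.smul_apply, ketbra, vecMulVec_apply, mul_diagonal, of_apply,
    conjTranspose_apply, smul_eq_mul, Pi.star_apply]
  exact Finset.sum_congr rfl fun i _ => by ring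

end Fidelity

/-! ### Tensor products of maps acting on rank-one operators. -/

section TensorMaps

variable {A B C A' B' W W' ι : Type*}

lemma ketbra_kronecker (u : A → ℂ) (v : B → ℂ) :
    ketbra u ⊗ₖ ketbra v = ketbra fun i => u i.1 * v i.2 := by
  ext i j
  simp [ketbra, vecMulVec_apply, kroneckerMap_apply, mul_mul_mul_comm]

lemma single_self_eq_ketbra [DecidableEq A] (a : A) :
    Matrix.single a a (1 : ℂ) = ketbra (Pi.single a 1) := by
  ext i j
  simp only [ketbra, vecMulVec_apply, single_apply, Pi.single_apply, Pi.star_apply]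
  rcases eq_or_ne i a with rfl | h1
  · rcases eq_or_ne j i with rfl | h2
    · simp
    · simp [h2, h2.symm]
  · simp [h1, h1.symm]

lemma submatrix_sum_smul_ketbra (t : Finset ι) (p : ι → ℂ) (v : ι → A → ℂ) (f : B → A) :
    (∑ i ∈ t, p i • ketbra (v i)).submatrix f f = ∑ i ∈ t, p i • ketbra (v i ∘ f) := by
  ext a b
  simp [Matrix.sum_apply, ketbra, vecMulVec_apply]

lemma conjMap_vecMulVec [Fintype A] (U : Matrix A' A ℂ) (u v : A → ℂ) :
    conjMap U (vecMulVec u (star v)) = vecMulVec (U *ᵥ u) (star (U *ᵥ v)) := by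
  simp [conjMap, mul_vecMulVec, vecMulVec_mul, star_mulVec]

/-- The action of `U ⊗ T` on vectors, for a matrix `U` and a map `T` of vectors. -/
def tensorVec [Fintype A] (U : Matrix A' A ℂ) (T : (B → ℂ) → B' → ℂ) (v : A × B → ℂ) :
    A' × B' → ℂ :=
  fun i => ∑ a, U i.1 a * T (fun b => v (a, b)) i.2

/-- The blocks of a rank-one operator are cross terms `|u_a⟩⟨v_a'|`, hence two vectors in the
hypothesis. The conclusion has the same shape, so the lemma can be nested. -/
lemma tensorMap_conjMap_vecMulVec [Fintype A] (U : Matrix A' A ℂ) {Ψ : Op B →ₗ[ℂ] Op B'}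
    {T : (B → ℂ) → B' → ℂ} (hT : ∀ u v, Ψ (vecMulVec u (star v)) = vecMulVec (T u) (star (T v)))
    (u v : A × B → ℂ) :
    tensorMap (conjMap U) Ψ (vecMulVec u (star v)) =
      vecMulVec (tensorVec U T u) (star (tensorVec U T v)) := by
  ext i j
  have h1 : ∀ a a' : A, (of fun b b' => vecMulVec u (star v) (a, b) (a', b') : Op B) =
      vecMulVec (fun b => u (a, b)) (star fun b => v (a', b)) := fun a a' => rfl
  have h2 : (of fun a a' => idTensor A Ψ (vecMulVec u (star v)) (a, i.2) (a', j.2) : Op A) =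
      vecMulVec (fun a => T (fun b => u (a, b)) i.2) (star fun a => T (fun b => v (a, b)) j.2) := by
    ext a a'
    simp only [idTensor, LinearMap.coe_mk, AddHom.coe_mk, of_apply, h1, hT]
    rfl
  change conjMap U (of fun a a' => idTensor A Ψ (vecMulVec u (star v)) (a, i.2) (a', j.2))
    i.1 j.1 = _
  rw [h2, conjMap_vecMulVec]
  rfl

lemma tensorMap_sum_sum [Fintype W] [Fintype W'] (Φ : W → Op A →ₗ[ℂ] Op A')
    (Ψ : W' → Op B →ₗ[ℂ] Op B') :
    tensorMap (∑ w, Φ w) (∑ w', Ψ w') = ∑ w, ∑ w', tensorMap (Φ w) (Ψ w') := by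
  ext1 ρ
  ext i j
  simp only [LinearMap.sum_apply, Matrix.sum_apply]
  have h : (of fun a a' => idTensor A (∑ w', Ψ w') ρ (a, i.2) (a', j.2) : Op A) =
      ∑ w', (of fun a a' => idTensor A (Ψ w') ρ (a, i.2) (a', j.2) : Op A) := by
    ext a a'
    simp [idTensor, Matrix.sum_apply]
  change (∑ w, Φ w) (of fun a a' => idTensor A (∑ w', Ψ w') ρ (a, i.2) (a', j.2)) i.1 j.1 = _
  simp only [LinearMap.sum_apply, Matrix.sum_apply]
  refine Finset.sum_congr rfl fun w _ => ?_
  rw [h, map_sum, Matrix.sum_apply]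
  rfl

/-- The Kraus operators of a Stinespring dilation. -/
def krausOp (U : Matrix (A' × W) A ℂ) (w : W) : Matrix A' A ℂ := of fun a' a => U (a', w) a

/-- Tracing out the environment in its standard basis gives one Kraus operator for each basis
element. -/
lemma IsStinespring.map_eq_sum_krausOp [Fintype A] [Fintype A'] [Fintype W] [DecidableEq A]
    {E : Channel A A'} {U : Matrix (A' × W) A ℂ} (h : IsStinespring E U) :
    E.map = ∑ w, conjMap (krausOp U w) := by
  ext1 ρ
  rw [h.2, LinearMap.sum_apply]
  ext a a'
  simp [traceRight, conjMap, Matrix.sum_apply, mul_apply, krausOp]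

lemma sum_norm_sq_mulVec [Fintype A] [Fintype B] [DecidableEq B] {U : Matrix A B ℂ}
    (hU : Uᴴ * U = 1) (v : B → ℂ) : ∑ i, ‖(U *ᵥ v) i‖ ^ 2 = ∑ i, ‖v i‖ ^ 2 := by
  have h1 : star (U *ᵥ v) ⬝ᵥ (U *ᵥ v) = star v ⬝ᵥ v := by
    rw [star_mulVec, dotProduct_mulVec, vecMul_vecMul, hU, vecMul_one]
  rw [star_dotProduct_self, star_dotProduct_self] at h1
  exact_mod_cast h1

lemma sum_norm_sq_tensorVec [Fintype A] [Fintype B] [Fintype A'] [Fintype B'] [DecidableEq A]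
    {U : Matrix A' A ℂ} (hU : Uᴴ * U = 1) {T : (B → ℂ) → B' → ℂ}
    (hT : ∀ v, ∑ i, ‖T v i‖ ^ 2 = ∑ i, ‖v i‖ ^ 2) (v : A × B → ℂ) :
    ∑ i, ‖tensorVec U T v i‖ ^ 2 = ∑ i, ‖v i‖ ^ 2 := by
  rw [Fintype.sum_prod_type_right, Fintype.sum_prod_type]
  calc _ = ∑ b, ∑ a, ‖T (fun b => v (a, b)) b‖ ^ 2 :=
        Finset.sum_congr rfl fun b _ => sum_norm_sq_mulVec hU fun a => T (fun b => v (a, b)) b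
    _ = ∑ a, ∑ b, ‖T (fun b => v (a, b)) b‖ ^ 2 := Finset.sum_comm
    _ = _ := Finset.sum_congr rfl fun a _ => hT _

end TensorMaps

lemma submatrix_finset_sum {α β ι : Type*} (t : Finset ι) (M : ι → Op α) (f : β → α) :
    (∑ i ∈ t, M i).submatrix f f = ∑ i ∈ t, (M i).submatrix f f := by
  ext a b
  simp [Matrix.sum_apply]

lemma tensorMap_conjMap_id_ketbra {A A' C : Type*} [Fintype A] (U : Matrix A' A ℂ)
    (v : A × C → ℂ) :
    tensorMap (conjMap U) LinearMap.id (ketbra v) = ketbra (tensorVec U id v) :=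
  tensorMap_conjMap_vecMulVec U (fun _ _ => rfl) v v

lemma sum_rotate_four {α β γ δ M : Type*} [Fintype α] [Fintype β] [Fintype γ] [Fintype δ]
    [AddCommMonoid M] (f : α → β → γ → δ → M) :
    ∑ a, ∑ b, ∑ c, ∑ d, f a b c d = ∑ d, ∑ b, ∑ c, ∑ a, f a b c d :=
  calc _ = ∑ a, ∑ d, ∑ b, ∑ c, f a b c d := Finset.sum_congr rfl fun _ _ =>
        (Finset.sum_congr rfl fun _ _ => Finset.sum_comm).trans Finset.sum_comm
    _ = ∑ d, ∑ a, ∑ b, ∑ c, f a b c d := Finset.sum_comm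
    _ = _ := Finset.sum_congr rfl fun _ _ =>
        Finset.sum_comm.trans (Finset.sum_congr rfl fun _ _ => Finset.sum_comm)

lemma submatrix_smul_ketbra {α β : Type*} (c : ℂ) (v : α → ℂ) (f : β → α) :
    (c • ketbra v).submatrix f f = c • ketbra (v ∘ f) := rfl

lemma tensorMap_sum_left {A B A' B' W : Type*} [Fintype W] (Φ : W → Op A →ₗ[ℂ] Op A')
    (Ψ : Op B →ₗ[ℂ] Op B') : tensorMap (∑ w, Φ w) Ψ = ∑ w, tensorMap (Φ w) Ψ := by
  simpa using tensorMap_sum_sum Φ fun _ : Unit => Ψ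

section Vectors

variable {A B : Type*}

lemma sum_norm_sq_mul [Fintype A] [Fintype B] (u : A → ℂ) (v : B → ℂ) :
    ∑ i : A × B, ‖u i.1 * v i.2‖ ^ 2 = (∑ a, ‖u a‖ ^ 2) * ∑ b, ‖v b‖ ^ 2 := by
  simp only [norm_mul, mul_pow, Fintype.sum_prod_type, Finset.sum_mul_sum]

lemma sum_norm_sq_single [Fintype A] [DecidableEq A] (a : A) :
    ∑ i, ‖(Pi.single a (1 : ℂ) : A → ℂ) i‖ ^ 2 = 1 := by
  rw [Finset.sum_eq_single a]
  · simp
  · intro b _ hb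
    simp [hb]
  · simp

end Vectors

/-- The vector `K^{-1/2} ∑_i |i⟩|i⟩`. -/
def maxEntangledVec (K : ℕ) : Fin K × Fin K → ℂ :=
  fun i => if i.1 = i.2 then ((1 / Real.sqrt K : ℝ) : ℂ) else 0

lemma sum_norm_sq_maxEntangledVec {K : ℕ} (hK : 0 < K) :
    ∑ i, ‖maxEntangledVec K i‖ ^ 2 = 1 := by
  have hK' : (K : ℝ) ≠ 0 := by exact_mod_cast hK.ne'
  have h : ∀ i j : Fin K, ‖maxEntangledVec K (i, j)‖ ^ 2 = if i = j then (K : ℝ)⁻¹ else 0 := by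
    intro i j
    by_cases hij : i = j <;> simp [maxEntangledVec, hij]
  simp [Fintype.sum_prod_type, h, hK']

/-! ### Reorderings of the registers as bijections, which preserve norms of vectors. -/

section Registers

variable {X B R CX CB WX WB WD : Type*} {n K L : ℕ}

/-- The reordering of the registers before the encoding. -/
def inputEquiv (X B R K₁ K₂ : Type*) :
    (X × ((B × K₁) × (K₂ × (X × R)))) ≃ (((X × X) × (B × R)) × (K₁ × K₂)) where
  toFun := fun (x, ((b, b₀), (d₀, (x', r)))) => (((x, x'), (b, r)), (b₀, d₀))
  invFun := fun (((x, x'), (b, r)), (b₀, d₀)) => (x, ((b, b₀), (d₀, (x', r))))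
  left_inv _ := rfl
  right_inv _ := rfl

/-- The reordering of the registers between the encoding and the decoding. -/
def receivedEquiv (CX CB WX WB K L X R : Type*) :
    (((CX × CB) × K) × (WX × WB × L × X × R)) ≃ ((CX × WX) × (((CB × L) × WB) × (K × (X × R)))) where
  toFun := fun (((cx, cb), d₀), (wx, wb, b₀', x', r)) => ((cx, wx), (((cb, b₀'), wb), (d₀, (x', r))))
  invFun := fun ((cx, wx), (((cb, b₀'), wb), (d₀, (x', r)))) =>
    (((cx, cb), d₀), (wx, wb, b₀', x', r))
  left_inv _ := rfl
  right_inv _ := rfl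

/-- The reordering of the registers after the decoding. -/
def finalEquiv (WX WB WD L X B R : Type*) :
    ((WX × WB × WD × L × L) × (X × B × R) × X) ≃
      ((((X × B) × L) × WD) × (WX × WB × L × X × R)) where
  toFun := fun ((wx, wb, wd, b₀', d₀'), (x, b, r), x') => ((((x, b), d₀'), wd), (wx, wb, b₀', x', r))
  invFun := fun ((((x, b), d₀'), wd), (wx, wb, b₀', x', r)) =>
    ((wx, wb, wd, b₀', d₀'), (x, b, r), x')
  left_inv _ := rfl
  right_inv _ := rfl

end Registers

/-! ### The source state as a mixture of unit vectors. -/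

namespace Source

variable {X B R : Type*} [Fintype X] [Fintype B] [Fintype R] (s : Source X B R)

/-- The vector `|x⟩|x⟩|ψ_x⟩|Φ_K⟩`. -/
def sourceVec [DecidableEq X] (n K : ℕ) (x : Fin n → X) :
    (((Fin n → X) × (Fin n → X)) × ((Fin n → B) × (Fin n → R))) × (Fin K × Fin K) → ℂ :=
  fun i => ((Pi.single x (1 : ℂ) : (Fin n → X) → ℂ) i.1.1.1 *
    (Pi.single x (1 : ℂ) : (Fin n → X) → ℂ) i.1.1.2 * s.ψn n x i.1.2) * maxEntangledVec K i.2

lemma omega_kronecker_maxEntangled [DecidableEq X] (n K : ℕ) :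
    s.omega n ⊗ₖ maxEntangled K = ∑ x, (s.pn n x : ℂ) • ketbra (s.sourceVec n K x) := by
  have h : ∀ x : Fin n → X, ketbra (s.sourceVec n K x) =
      ((Matrix.single x x (1 : ℂ) ⊗ₖ Matrix.single x x (1 : ℂ)) ⊗ₖ ketbra (s.ψn n x)) ⊗ₖ
        maxEntangled K := by
    intro x
    rw [single_self_eq_ketbra, ketbra_kronecker, ketbra_kronecker, maxEntangled, ketbra_kronecker]
    rfl
  simp_rw [h]
  ext i j
  rw [kroneckerMap_apply, omega]
  simp only [Matrix.sum_apply, Matrix.smul_apply, Finset.sum_mul]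
  refine Finset.sum_congr rfl fun x _ => ?_
  rw [smul_eq_mul, smul_eq_mul, mul_assoc]
  rfl

lemma sum_norm_sq_ψn (n : ℕ) (x : Fin n → X) : ∑ i, ‖s.ψn n x i‖ ^ 2 = 1 := by
  have h := (Equiv.arrowProdEquivProdArrow (Fin n) (fun _ => B) fun _ => R).sum_comp
    fun i => ‖s.ψn n x i‖ ^ 2
  rw [← h]
  have h2 : ∀ f : Fin n → B × R, ‖s.ψn n x (Equiv.arrowProdEquivProdArrow (Fin n) (fun _ => B)
      (fun _ => R) f)‖ ^ 2 = ∏ i, ‖s.ψ (x i) (f i)‖ ^ 2 := by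
    intro f
    simp [ψn, Equiv.arrowProdEquivProdArrow, norm_prod, Finset.prod_pow]
  simp_rw [h2]
  rw [← Fintype.prod_sum fun i j => ‖s.ψ (x i) j‖ ^ 2]
  simp [s.ψ_norm]

lemma pn_nonneg (n : ℕ) (x : Fin n → X) : 0 ≤ s.pn n x :=
  Finset.prod_nonneg fun _ _ => s.p_nonneg _

lemma sum_pn (n : ℕ) : ∑ x, s.pn n x = 1 := by
  unfold pn
  rw [← Fintype.prod_sum]
  simp [s.p_sum]

lemma sum_norm_sq_sourceVec [DecidableEq X] (n : ℕ) {K : ℕ} (hK : 0 < K) (x : Fin n → X) :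
    ∑ i, ‖s.sourceVec n K x i‖ ^ 2 = 1 := by
  unfold sourceVec
  rw [sum_norm_sq_mul (fun i : (((Fin n → X) × (Fin n → X)) × ((Fin n → B) × (Fin n → R))) =>
      (Pi.single x (1 : ℂ) : (Fin n → X) → ℂ) i.1.1 *
      (Pi.single x (1 : ℂ) : (Fin n → X) → ℂ) i.1.2 * s.ψn n x i.2) (maxEntangledVec K),
    sum_norm_sq_mul (fun i : (Fin n → X) × (Fin n → X) =>
      (Pi.single x (1 : ℂ) : (Fin n → X) → ℂ) i.1 *
      (Pi.single x (1 : ℂ) : (Fin n → X) → ℂ) i.2) (s.ψn n x),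
    sum_norm_sq_mul (Pi.single x (1 : ℂ) : (Fin n → X) → ℂ) (Pi.single x (1 : ℂ)),
    sum_norm_sq_single, sum_norm_sq_ψn, sum_norm_sq_maxEntangledVec hK]
  norm_num

end Source

/-! ### The final and output states as mixtures of pure components. -/

section FinalVec

variable {X B R CX CB WX WB WD : Type*} [Fintype X] [Fintype B] [Fintype R]
  [Fintype CX] [Fintype CB]
  [DecidableEq X] {n K L : ℕ}
  (s : Source X B R)

/-- The vector obtained from `|x⟩|x⟩|ψ_x⟩|Φ_K⟩` by the encoding operators. -/
def encodedVec {CX' CB' : Type*} (UX : Matrix CX' (Fin n → X) ℂ)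
    (UB : Matrix CB' ((Fin n → B) × Fin K) ℂ) (x : Fin n → X) :
    CX' × (CB' × (Fin K × ((Fin n → X) × (Fin n → R)))) → ℂ :=
  tensorVec UX (tensorVec UB id)
    (s.sourceVec n K x ∘ inputEquiv (Fin n → X) (Fin n → B) (Fin n → R) (Fin K) (Fin K))

/-- The component of the final state for the source sequence `x`. -/
def finalVec (UX : Matrix (CX × WX) (Fin n → X) ℂ)
    (UB : Matrix ((CB × Fin L) × WB) ((Fin n → B) × Fin K) ℂ)
    (V : Matrix ((((Fin n → X) × (Fin n → B)) × Fin L) × WD) ((CX × CB) × Fin K) ℂ)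
    (x : Fin n → X) :
    (WX × WB × WD × Fin L × Fin L) × ((Fin n → X) × (Fin n → B) × (Fin n → R)) ×
      (Fin n → X) → ℂ :=
  (tensorVec V id
    (encodedVec s UX UB x ∘ receivedEquiv CX CB WX WB (Fin K) (Fin L) (Fin n → X) (Fin n → R))) ∘
    finalEquiv WX WB WD (Fin L) (Fin n → X) (Fin n → B) (Fin n → R)

variable (UX : Matrix (CX × WX) (Fin n → X) ℂ)
  (UB : Matrix ((CB × Fin L) × WB) ((Fin n → B) × Fin K) ℂ)
  (V : Matrix ((((Fin n → X) × (Fin n → B)) × Fin L) × WD) ((CX × CB) × Fin K) ℂ)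

lemma inputState_eq_sum_ketbra : s.inputState n K = ∑ x, (s.pn n x : ℂ) •
    ketbra (s.sourceVec n K x ∘
      inputEquiv (Fin n → X) (Fin n → B) (Fin n → R) (Fin K) (Fin K)) := by
  rw [← submatrix_sum_smul_ketbra, ← Source.omega_kronecker_maxEntangled]
  rfl

lemma tensorMap_encode_inputState {CX' CB' : Type*} (UX : Matrix CX' (Fin n → X) ℂ)
    (UB : Matrix CB' ((Fin n → B) × Fin K) ℂ) :
    tensorMap (conjMap UX) (tensorMap (conjMap UB) LinearMap.id) (s.inputState n K) =
      ∑ x, (s.pn n x : ℂ) • ketbra (encodedVec s UX UB x) := by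
  rw [inputState_eq_sum_ketbra, map_sum]
  refine Finset.sum_congr rfl fun x _ => ?_
  rw [map_smul, ketbra, tensorMap_conjMap_vecMulVec UX
    (tensorMap_conjMap_vecMulVec UB (T := id) fun _ _ => rfl)]
  rfl

lemma finalState_eq_sum_ketbra : finalState s UX UB V =
    ∑ x, (s.pn n x : ℂ) • ketbra (finalVec s UX UB V x) := by
  unfold finalState
  simp only
  rw [tensorMap_encode_inputState, submatrix_sum_smul_ketbra, map_sum]
  simp only [map_smul, tensorMap_conjMap_id_ketbra]
  rw [submatrix_sum_smul_ketbra]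
  rfl

/-- The output state is `ξ` with the three environments traced out; writing it with slices of the
same `finalVec` ties the fidelity of the code to `ξ`. -/
lemma outputState_eq_sum_ketbra [Fintype WX] [Fintype WB] [Fintype WD]
    [DecidableEq B] [DecidableEq CX] [DecidableEq CB]
    (code : EACode X B CX CB n K L)
    (hUX : IsStinespring code.encX UX) (hUB : IsStinespring code.encB UB)
    (hV : IsStinespring code.dec V) : code.outputState s =
    ∑ x, (s.pn n x : ℂ) • ∑ w : WX × WB × WD, ketbra
      (fun i : (((Fin n → X) × (Fin n → X)) × ((Fin n → B) × (Fin n → R))) × (Fin L × Fin L) =>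
        finalVec s UX UB V x
          ((w.1, w.2.1, w.2.2, i.2.1, i.2.2), (i.1.1.1, i.1.2.1, i.1.2.2), i.1.1.2)) := by
  have hE : ∀ ρ, tensorMap code.encX.map (tensorMap code.encB.map LinearMap.id) ρ =
      ∑ wx, ∑ wb, tensorMap (conjMap (krausOp UX wx)) (tensorMap (conjMap (krausOp UB wb))
        (LinearMap.id (R := ℂ) (M := Op (Fin K × ((Fin n → X) × (Fin n → R)))))) ρ := by
    intro ρ
    rw [hUX.map_eq_sum_krausOp, hUB.map_eq_sum_krausOp, tensorMap_sum_left _ LinearMap.id, tensorMap_sum_sum]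
    simp only [LinearMap.sum_apply]
  have hD : ∀ ρ, tensorMap code.dec.map
      (LinearMap.id (R := ℂ) (M := Op (Fin L × ((Fin n → X) × (Fin n → R))))) ρ =
      ∑ wd, tensorMap (conjMap (krausOp V wd)) LinearMap.id ρ := by
    intro ρ
    rw [hV.map_eq_sum_krausOp, tensorMap_sum_left, LinearMap.sum_apply]
  unfold EACode.outputState
  simp only [hE, hD, tensorMap_encode_inputState, submatrix_finset_sum, submatrix_smul_ketbra,
    map_sum, map_smul, tensorMap_conjMap_id_ketbra]
  rw [sum_rotate_four]
  simp only [Finset.smul_sum, Fintype.sum_prod_type]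
  rfl

/-- The coefficients of the final vector in the vectors `∑ᵣ ψ_x(b, r) |r⟩`. -/
def finalCoeff (x : Fin n → X)
    (w : WX × WB × WD × Fin L × Fin L) (xh : Fin n → X) (bh b : Fin n → B) : ℂ :=
  ∑ c : (CX × CB) × Fin K, V (((xh, bh), w.2.2.2.2), w.2.2.1) c *
    (UX (c.1.1, w.1) x * ∑ b₀, UB ((c.1.2, w.2.2.2.1), w.2.1) (b, b₀) * maxEntangledVec K (b₀, c.2))

/-- Two facts are read off later: the register `X'ⁿ` still carries `x`, and `r` occurs only inside
`ψ_x(b, r)`, since no operation touches `Rⁿ`. -/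
lemma finalVec_apply (x : Fin n → X) (w : WX × WB × WD × Fin L × Fin L) (xh : Fin n → X)
    (bh : Fin n → B) (r : Fin n → R) (x' : Fin n → X) :
    finalVec s UX UB V x (w, (xh, bh, r), x') =
      if x' = x then ∑ b, finalCoeff UX UB V x w xh bh b * s.ψn n x (b, r) else 0 := by
  obtain ⟨wx, wb, wd, l, l'⟩ := w
  have henc : ∀ (cx : CX × WX) (cb : (CB × Fin L) × WB) (d : Fin K),
      encodedVec s UX UB x (cx, (cb, (d, (x', r)))) = if x' = x then
        ∑ b, UX cx x * (∑ b₀, UB cb (b, b₀) * maxEntangledVec K (b₀, d)) * s.ψn n x (b, r)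
      else 0 := by
    intro cx cb d
    rw [encodedVec, tensorVec, Finset.sum_eq_single x]
    · simp only [tensorVec, id_eq, Function.comp_apply, inputEquiv, Equiv.coe_fn_mk, Source.sourceVec,
        Pi.single_apply, if_true, one_mul, Fintype.sum_prod_type, Finset.mul_sum, Finset.sum_mul]
      split_ifs
      · exact Finset.sum_congr rfl fun b _ => Finset.sum_congr rfl fun b₀ _ => by ring
      · simp
    · intro x₁ _ hx
      simp [tensorVec, inputEquiv, Source.sourceVec, hx]
    · simp
  simp only [finalVec, tensorVec, id_eq, Function.comp_apply, finalEquiv, receivedEquiv,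
    Equiv.coe_fn_mk, henc]
  split_ifs
  · simp only [finalCoeff, Finset.sum_mul]
    rw [Finset.sum_comm]
    refine Finset.sum_congr rfl fun c _ => ?_
    rw [Finset.mul_sum]
    exact Finset.sum_congr rfl fun b _ => by ring
  · simp

lemma sum_norm_sq_finalVec [Fintype WX] [Fintype WB] [Fintype WD]
    [DecidableEq B] [DecidableEq CX] [DecidableEq CB] (hUX : UXᴴ * UX = 1) (hUB : UBᴴ * UB = 1) (hV : Vᴴ * V = 1)
    (hK : 0 < K) (x : Fin n → X) : ∑ i, ‖finalVec s UX UB V x i‖ ^ 2 = 1 := by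
  unfold finalVec
  simp only [Function.comp_apply]
  rw [(finalEquiv WX WB WD (Fin L) (Fin n → X) (Fin n → B) (Fin n → R)).sum_comp
    fun i => ‖tensorVec V id (encodedVec s UX UB x ∘
      receivedEquiv CX CB WX WB (Fin K) (Fin L) (Fin n → X) (Fin n → R)) i‖ ^ 2,
    sum_norm_sq_tensorVec (T := id) hV fun _ => rfl]
  simp only [Function.comp_apply]
  rw [(receivedEquiv CX CB WX WB (Fin K) (Fin L) (Fin n → X) (Fin n → R)).sum_comp
    fun i => ‖encodedVec s UX UB x i‖ ^ 2, encodedVec,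
    sum_norm_sq_tensorVec hUX (sum_norm_sq_tensorVec (T := id) hUB fun _ => rfl)]
  simp only [Function.comp_apply]
  rw [(inputEquiv (Fin n → X) (Fin n → B) (Fin n → R) (Fin K) (Fin K)).sum_comp
    fun i => ‖s.sourceVec n K x i‖ ^ 2, s.sum_norm_sq_sourceVec n hK]

end FinalVec

/-! ### Conditional mutual information with a classical conditioning register. -/

section ClassicalQuantum

variable {W Y Z : Type*} [Fintype W] [Fintype Y] [Fintype Z] [DecidableEq W] [DecidableEq Y]
  [DecidableEq Z]

lemma isHermitian_real_smul {W : Type*} {A : Op W} (hA : A.IsHermitian) (c : ℝ) :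
    ((c : ℂ) • A).IsHermitian := by
  rw [IsHermitian, conjTranspose_smul, hA]
  simp

lemma trace_mul_conjTranspose_self {W Y : Type*} [Fintype W] [Fintype Y] (M : Matrix W Y ℂ) :
    (M * Mᴴ).trace = ((∑ i : W × Y, ‖M i.1 i.2‖ ^ 2 : ℝ) : ℂ) := by
  simp [trace, mul_apply, Complex.mul_conj, Complex.normSq_eq_norm_sq, Fintype.sum_prod_type]

/-- The conditional mutual information of a state that is classical on the conditioning register,
with pure conditional states. -/
lemma condMutualInfo_classical_pure (p : Z → ℝ) (M : Z → Matrix W Y ℂ)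
    (hM : ∀ z, ∑ i : W × Y, ‖M z i.1 i.2‖ ^ 2 = 1) {ζ : Z → W × Y × Z → ℂ}
    (hζ : ∀ z i, ζ z i = if i.2.2 = z then M z i.1 i.2.1 else 0) :
    condMutualInfo (∑ z, (p z : ℂ) • ketbra (ζ z)) =
      2 * ∑ z, p z * entropy ((M z)ᴴ * M z) := by
  have hentry : ∀ w y z w' y' z', (∑ z, (p z : ℂ) • ketbra (ζ z)) (w, y, z) (w', y', z') =
      if z = z' then (p z : ℂ) * (M z w y * star (M z w' y')) else 0 := by
    intro w y z w' y' z'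
    simp only [Matrix.sum_apply, Matrix.smul_apply, ketbra, vecMulVec_apply, Pi.star_apply, hζ,
      smul_eq_mul]
    rw [Finset.sum_eq_single z]
    · rcases eq_or_ne z z' with rfl | h
      · simp
      · simp [h, h.symm]
    · intro x _ hx
      simp [hx.symm]
    · simp
  generalize (∑ z, (p z : ℂ) • ketbra (ζ z)) = ρ at hentry
  have htr : ∀ z, (M z * (M z)ᴴ).trace = 1 := fun z => by
    rw [trace_mul_conjTranspose_self, hM, Complex.ofReal_one]
  have htr' : ∀ z, ((M z)ᴴ * M z)ᵀ.trace = 1 := fun z => by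
    rw [trace_transpose, trace_mul_comm, htr]
  have hk : ∀ z, (ketbra fun i : W × Y => M z i.1 i.2).trace = 1 := fun z => by
    rw [trace_ketbra, hM, Complex.ofReal_one]
  have hAC : (traceRight (B := Y) (ρ.submatrix (fun ((a, c), b) => (a, b, c))
      (fun ((a, c), b) => (a, b, c))) : Op (W × Z)) =
      blockDiagonal fun z => (p z : ℂ) • (M z * (M z)ᴴ) := by
    ext ⟨w, z⟩ ⟨w', z'⟩
    simp only [traceRight, of_apply, submatrix_apply, hentry, blockDiagonal_apply,
      Matrix.smul_apply, mul_apply, conjTranspose_apply, smul_eq_mul]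
    split_ifs <;> simp [Finset.mul_sum]
  have hBC : (traceRight (B := W) (ρ.submatrix (fun ((b, c), a) => (a, b, c))
      (fun ((b, c), a) => (a, b, c))) : Op (Y × Z)) =
      blockDiagonal fun z => (p z : ℂ) • ((M z)ᴴ * M z)ᵀ := by
    ext ⟨y, z⟩ ⟨y', z'⟩
    simp only [traceRight, of_apply, submatrix_apply, hentry, blockDiagonal_apply,
      Matrix.smul_apply, transpose_apply, mul_apply, conjTranspose_apply, smul_eq_mul]
    split_ifs
    · rw [Finset.mul_sum]
      exact Finset.sum_congr rfl fun w _ => by ring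
    · simp
  have hABC : ρ = (blockDiagonal fun z => (p z : ℂ) • ketbra fun i : W × Y =>
      M z i.1 i.2).submatrix (Equiv.prodAssoc W Y Z).symm (Equiv.prodAssoc W Y Z).symm := by
    ext ⟨w, y, z⟩ ⟨w', y', z'⟩
    simp only [hentry, submatrix_apply, Equiv.prodAssoc_symm_apply, blockDiagonal_apply,
      Matrix.smul_apply, ketbra, vecMulVec_apply, Pi.star_apply, smul_eq_mul]
  have hC : (traceRight (B := W × Y) (ρ.submatrix (fun (c, (a, b)) => (a, b, c))
      (fun (c, (a, b)) => (a, b, c))) : Op Z) = diagonal fun z => (p z : ℂ) := by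
    ext z z'
    simp only [traceRight, of_apply, submatrix_apply, hentry, diagonal_apply]
    split_ifs with h
    · subst h
      have := htr z
      rw [trace_mul_conjTranspose_self] at this
      rw [← Finset.mul_sum]
      simp only [Complex.star_def, Complex.mul_conj, Complex.normSq_eq_norm_sq]
      rw [← Complex.ofReal_sum, this, mul_one]
    · simp
  have hherm : ∀ z, (M z * (M z)ᴴ).IsHermitian := fun z => isHermitian_mul_conjTranspose_self _
  have hherm' : ∀ z, ((M z)ᴴ * M z).IsHermitian := fun z => isHermitian_conjTranspose_mul_self _
  have e1 := congrArg entropy hAC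
  have e2 := congrArg entropy hBC
  have e3 := congrArg entropy hABC
  have e4 := congrArg entropy hC
  rw [entropy_blockDiagonal fun z => isHermitian_real_smul (hherm z) _] at e1
  rw [entropy_blockDiagonal fun z => isHermitian_real_smul (hherm' z).transpose _] at e2
  rw [entropy_submatrix_equiv, entropy_blockDiagonal fun z =>
    isHermitian_real_smul (isHermitian_ketbra _) _] at e3
  swap
  · rw [IsHermitian, blockDiagonal_conjTranspose]
    congr 1
    funext z
    exact isHermitian_real_smul (isHermitian_ketbra _) _
  rw [entropy_diagonal] at e4
  simp_rw [fun z => entropy_smul (hherm z) (htr z), ← entropy_conjTranspose_mul_self,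
    Finset.sum_add_distrib] at e1
  simp_rw [fun z => entropy_smul (hherm' z).transpose (htr' z), entropy_transpose (hherm' _),
    Finset.sum_add_distrib] at e2
  simp_rw [fun z => entropy_smul (isHermitian_ketbra _) (hk z), fun z => entropy_ketbra (hM z),
    Finset.sum_add_distrib] at e3
  -- The Shannon entropy of `p` occurs in all four terms and cancels. The pure blocks contribute
  -- nothing to `S(ABC)`, and the two marginals of each block have equal entropy, whence the factor
  -- 2.
  unfold condMutualInfo
  simp only at e1 e2 e4 ⊢
  rw [e1, e2, e3, e4]
  simp
  ring

end ClassicalQuantum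

/-! ### The Fano inequality averaged over an ensemble. -/

section Average

variable {m ι : Type*} [Fintype m] [DecidableEq m] [Fintype ι]

lemma re_dotProduct_le_one {A : Op m} (hA : A.PosSemidef) (htr : A.trace = 1) {v : m → ℂ}
    (hv : ∑ i, ‖v i‖ ^ 2 = 1) : (star v ⬝ᵥ A *ᵥ v).re ≤ 1 := by
  obtain ⟨i, hi⟩ := exists_re_dotProduct_le_eigenvalue hA.1 hv
  rw [← sum_eigenvalues_eq_one hA htr]
  exact hi.trans (Finset.single_le_sum (fun j _ => hA.eigenvalues_nonneg j) (Finset.mem_univ i))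

/-- The average entropy of density operators of rank at most `D` whose average overlap with pure
states is at least `1 - s`. -/
lemma sum_mul_entropy_le {p : ι → ℝ} (hp : ∀ x, 0 ≤ p x) (hp1 : ∑ x, p x = 1) {A : ι → Op m}
    (hA : ∀ x, (A x).PosSemidef) (htr : ∀ x, (A x).trace = 1) {D : ℕ} (hD : 0 < D)
    (hr : ∀ x, (A x).rank ≤ D) {v : ι → m → ℂ} (hv : ∀ x, ∑ i, ‖v x i‖ ^ 2 = 1) {s : ℝ}
    (hs0 : 0 ≤ s) (hs1 : s ≤ 1) (hf : 1 - s ≤ ∑ x, p x * (star (v x) ⬝ᵥ A x *ᵥ v x).re) :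
    ∑ x, p x * entropy (A x) ≤ binaryEntropy s + s * Real.logb 2 D := by
  have hD1 : (1 : ℝ) ≤ D := by exact_mod_cast hD
  set f : ι → ℝ := fun x => (star (v x) ⬝ᵥ A x *ᵥ v x).re with hfdef
  rcases hs0.eq_or_lt with rfl | hs0
  -- At `s = 0` the Fano weights degenerate, but then every `x` of positive probability has overlap
  -- exactly one.
  · have hsum : ∑ x, p x * (1 - f x) ≤ 0 := by
      simp_rw [mul_sub, mul_one]
      rw [Finset.sum_sub_distrib, hp1]
      linarith
    have hnn : ∀ x ∈ Finset.univ, 0 ≤ p x * (1 - f x) := fun x _ =>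
      mul_nonneg (hp x) (sub_nonneg.2 (re_dotProduct_le_one (hA x) (htr x) (hv x)))
    have hzero := (Finset.sum_eq_zero_iff_of_nonneg hnn).1
      (le_antisymm hsum (Finset.sum_nonneg hnn))
    have : ∑ x, p x * entropy (A x) ≤ 0 := by
      refine Finset.sum_nonpos fun x hx => ?_
      rcases mul_eq_zero.1 (hzero x hx) with h | h
      · simp [h]
      · exact mul_nonpos_of_nonneg_of_nonpos (hp x)
          (entropy_nonpos_of_overlap_eq_one (hA x) (htr x) (hv x) (sub_eq_zero.1 h).le)
    simpa [binaryEntropy] using this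
  rcases le_total s (D * (1 - s)) with h | h
  · have hs1' : s < 1 := by
      by_contra hcon
      have : s = 1 := le_antisymm hs1 (not_lt.1 hcon)
      subst this
      norm_num at h
    have h1 : ∑ x, p x * entropy (A x) ≤ ∑ x, p x * (f x * -Real.logb 2 (1 - s) +
        (1 - f x) * (Real.logb 2 D - Real.logb 2 s)) :=
      Finset.sum_le_sum fun x _ => mul_le_mul_of_nonneg_left
        (entropy_le_fano (hA x) (htr x) (hr x) hD hs0 hs1' h (hv x)) (hp x)
    have h2 : ∑ x, p x * (f x * -Real.logb 2 (1 - s) +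
        (1 - f x) * (Real.logb 2 D - Real.logb 2 s)) =
        (∑ x, p x * f x) * (-Real.logb 2 (1 - s) - (Real.logb 2 D - Real.logb 2 s)) +
          (∑ x, p x) * (Real.logb 2 D - Real.logb 2 s) := by
      rw [Finset.sum_mul, Finset.sum_mul, ← Finset.sum_add_distrib]
      exact Finset.sum_congr rfl fun x _ => by ring
    have h3 : Real.logb 2 s ≤ Real.logb 2 D + Real.logb 2 (1 - s) := by
      rw [← Real.logb_mul (by linarith) (by linarith)]
      exact Real.logb_le_logb_of_le one_lt_two hs0 h
    -- The Fano bound is affine in the overlap with nonpositive slope, so only a lower bound on the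
    -- average overlap is needed and no concavity of `h`.
    have h4 := mul_le_mul_of_nonpos_right hf
      (by linarith : -Real.logb 2 (1 - s) - (Real.logb 2 D - Real.logb 2 s) ≤ 0)
    rw [h2, hp1] at h1
    unfold binaryEntropy
    linarith
  · refine le_trans ?_ (logb_le_binaryEntropy_add hD1 hs1 h)
    calc ∑ x, p x * entropy (A x) ≤ ∑ x, p x * Real.logb 2 D :=
          Finset.sum_le_sum fun x _ => mul_le_mul_of_nonneg_left
            (entropy_le_logb_rank (hA x) (htr x) (hr x) hD) (hp x)
      _ = Real.logb 2 D := by rw [← Finset.sum_mul, hp1, one_mul]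

end Average

/-! ### Overlap, rank and the final estimate for a code. -/

section Code

variable {X B R CX CB WX WB WD : Type*} [Fintype X] [Fintype B] [Fintype R]
  [Fintype CX] [Fintype CB] [DecidableEq X] {n K L : ℕ} (s : Source X B R)

lemma sourceVec_isometry (hL : 0 < L) :
    (of fun i x => s.sourceVec n L x i : Matrix _ (Fin n → X) ℂ)ᴴ *
      (of fun i x => s.sourceVec n L x i) = 1 := by
  ext x y
  simp only [mul_apply, conjTranspose_apply, of_apply]
  rcases eq_or_ne x y with rfl | h
  · have := star_dotProduct_self (s.sourceVec n L x)
    rw [s.sum_norm_sq_sourceVec n hL x] at this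
    simpa [dotProduct] using this
  · rw [Matrix.one_apply_ne h]
    refine Finset.sum_eq_zero fun i _ => ?_
    rcases eq_or_ne i.1.1.1 x with hi | hi
    · simp [Source.sourceVec, hi, h]
    · simp [Source.sourceVec, hi]

variable
  (UX : Matrix (CX × WX) (Fin n → X) ℂ)
  (UB : Matrix ((CB × Fin L) × WB) ((Fin n → B) × Fin K) ℂ)
  (V : Matrix ((((Fin n → X) × (Fin n → B)) × Fin L) × WD) ((CX × CB) × Fin K) ℂ)

/-- The vector `|x⟩|ψ_x⟩`. -/
def idealVec (x : Fin n → X) : (Fin n → X) × (Fin n → B) × (Fin n → R) → ℂ :=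
  fun y => (Pi.single x (1 : ℂ) : (Fin n → X) → ℂ) y.1 * s.ψn n x y.2

lemma sum_norm_sq_idealVec (x : Fin n → X) : ∑ y, ‖idealVec s x y‖ ^ 2 = 1 := by
  unfold idealVec
  rw [sum_norm_sq_mul (Pi.single x (1 : ℂ) : (Fin n → X) → ℂ) (s.ψn n x), sum_norm_sq_single,
    s.sum_norm_sq_ψn, one_mul]

/-- The final vector for the source sequence `x`, as a matrix. -/
def finalMatrix (x : Fin n → X) :
    Matrix (WX × WB × WD × Fin L × Fin L) ((Fin n → X) × (Fin n → B) × (Fin n → R)) ℂ :=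
  of fun w y => finalVec s UX UB V x (w, y, x)

/-- The matrix factors through the index set `Xⁿ × Bⁿ × Bⁿ`: the second copy of `Bⁿ` is the source
system that carries the correlation with `Rⁿ`. -/
lemma rank_finalMatrix_le (x : Fin n → X) : (finalMatrix s UX UB V x).rank ≤
    Fintype.card X ^ n * (Fintype.card B ^ n * Fintype.card B ^ n) := by
  classical
  let N : Matrix (WX × WB × WD × Fin L × Fin L)
      ((Fin n → X) × (Fin n → B) × (Fin n → B)) ℂ :=
    of fun w j => finalCoeff UX UB V x w j.1 j.2.1 j.2.2
  let P : Matrix ((Fin n → X) × (Fin n → B) × (Fin n → B))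
      ((Fin n → X) × (Fin n → B) × (Fin n → R)) ℂ :=
    of fun j y => if j.1 = y.1 ∧ j.2.1 = y.2.1 then s.ψn n x (j.2.2, y.2.2) else 0
  have h : finalMatrix s UX UB V x = N * P := by
    ext w ⟨xh, bh, r⟩
    simp only [finalMatrix, of_apply, finalVec_apply, if_true, mul_apply, N, P,
      Fintype.sum_prod_type]
    symm
    rw [Finset.sum_eq_single xh (fun x' _ hx' => by simp [hx']) (by simp),
      Finset.sum_eq_single bh (fun b _ hb => by simp [hb]) (by simp)]
    simp
  rw [h]
  refine (rank_mul_le_left N P).trans ((rank_le_card_width N).trans_eq ?_)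
  simp

variable [Fintype WX] [Fintype WB] [Fintype WD]

/-- The squared overlap of the final state for the source sequence `x` with `|x⟩|ψ_x⟩|Φ_L⟩`. -/
def codeOverlap (x : Fin n → X) : ℝ :=
  ∑ w : WX × WB × WD, ‖∑ i, star (s.sourceVec n L x i) * finalVec s UX UB V x
    ((w.1, w.2.1, w.2.2, i.2.1, i.2.2), (i.1.1.1, i.1.2.1, i.1.2.2), i.1.1.2)‖ ^ 2

set_option synthInstance.maxSize 1000 in
lemma avgFidelity_eq [DecidableEq B] [DecidableEq R] [DecidableEq CX] [DecidableEq CB]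
    (hL : 0 < L) (code : EACode X B CX CB n K L)
    (hUX : IsStinespring code.encX UX) (hUB : IsStinespring code.encB UB)
    (hV : IsStinespring code.dec V) :
    code.avgFidelity s = ∑ x, s.pn n x * Real.sqrt (codeOverlap s UX UB V x) := by
  unfold EACode.avgFidelity
  rw [Source.omega_kronecker_maxEntangled, sum_smul_ketbra,
    outputState_eq_sum_ketbra s UX UB V code hUX hUB hV]
  refine fidelity_isometry_conj_diagonal (g := codeOverlap s UX UB V) (sourceVec_isometry s hL)
    (s.pn_nonneg n) (fun x => Finset.sum_nonneg fun _ _ => sq_nonneg _) ?_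
  set S : Matrix _ (Fin n → X) ℂ := of fun i x => s.sourceVec n L x i with hS
  have hmul : ∀ ρ, Sᴴ * ρ * S = conjMap Sᴴ ρ := fun ρ => by simp [conjMap]
  rw [hmul]
  simp only [map_sum, map_smul, ketbra, conjMap_vecMulVec]
  ext a b
  simp only [Matrix.sum_apply, Matrix.smul_apply, vecMulVec_apply, Pi.star_apply]
  -- The component for `x` is orthogonal to every other ideal vector because `X'ⁿ` still holds `x`;
  -- this makes the compressed output state diagonal.
  have hne : ∀ x (w : WX × WB × WD) a, a ≠ x → (Sᴴ *ᵥ fun i => finalVec s UX UB V x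
      ((w.1, w.2.1, w.2.2, i.2.1, i.2.2), (i.1.1.1, i.1.2.1, i.1.2.2), i.1.1.2)) a = 0 := by
    intro x w a ha
    simp only [mulVec, dotProduct]
    refine Finset.sum_eq_zero fun i _ => ?_
    rw [finalVec_apply, conjTranspose_apply, hS, of_apply]
    rcases eq_or_ne i.1.1.2 x with hi | hi
    · simp [Source.sourceVec, hi, ha.symm]
    · simp [hi]
  rw [Finset.sum_eq_single a]
  · rcases eq_or_ne a b with rfl | hab
    · rw [diagonal_apply_eq, codeOverlap, smul_eq_mul, Complex.ofReal_mul, Complex.ofReal_sum]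
      congr 1
      refine Finset.sum_congr rfl fun w _ => ?_
      rw [Complex.star_def, Complex.mul_conj, Complex.normSq_eq_norm_sq]
      rfl
    · rw [diagonal_apply_ne _ hab]
      simp [hne a _ b hab.symm]
  · intro x _ hx
    simp [hne x _ a hx.symm]
  · simp

lemma norm_sq_sum_mul_le {ι : Type*} [Fintype ι] (a c : ι → ℂ) :
    ‖∑ i, a i * c i‖ ^ 2 ≤ (∑ i, ‖a i‖ ^ 2) * ∑ i, ‖c i‖ ^ 2 := by
  refine le_trans ?_ (Finset.sum_mul_sq_le_sq_mul_sq _ _ _)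
  refine pow_le_pow_left₀ (norm_nonneg _) ((norm_sum_le _ _).trans_eq ?_) 2
  simp

/-- For each environment outcome, projecting onto `Φ_L` after `|x⟩|ψ_x⟩` cannot increase the norm
(Cauchy–Schwarz). The test vector is conjugated because `Mᴴ * M` is the transpose of the marginal.
-/
lemma codeOverlap_le (hL : 0 < L) (x : Fin n → X) :
    codeOverlap s UX UB V x ≤ (star (star (idealVec s x)) ⬝ᵥ
      ((finalMatrix s UX UB V x)ᴴ * finalMatrix s UX UB V x) *ᵥ star (idealVec s x)).re := by
  have hval : star (star (idealVec s x)) ⬝ᵥ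
      ((finalMatrix s UX UB V x)ᴴ * finalMatrix s UX UB V x) *ᵥ star (idealVec s x) =
      ((∑ w, ‖(finalMatrix s UX UB V x *ᵥ star (idealVec s x)) w‖ ^ 2 : ℝ) : ℂ) := by
    rw [← star_dotProduct_self, star_mulVec, ← mulVec_mulVec, dotProduct_mulVec]
  rw [hval, Complex.ofReal_re]
  have hsplit : ∑ w, ‖(finalMatrix s UX UB V x *ᵥ star (idealVec s x)) w‖ ^ 2 =
      ∑ w : WX × WB × WD, ∑ l : Fin L × Fin L,
        ‖(finalMatrix s UX UB V x *ᵥ star (idealVec s x))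
          (w.1, w.2.1, w.2.2, l.1, l.2)‖ ^ 2 := by
    simp only [Fintype.sum_prod_type]
  rw [hsplit, codeOverlap]
  refine Finset.sum_le_sum fun w _ => ?_
  have hsum : ∑ i, star (s.sourceVec n L x i) * finalVec s UX UB V x
      ((w.1, w.2.1, w.2.2, i.2.1, i.2.2), (i.1.1.1, i.1.2.1, i.1.2.2), i.1.1.2) =
      ∑ l : Fin L × Fin L, star (maxEntangledVec L l) *
        (finalMatrix s UX UB V x *ᵥ star (idealVec s x)) (w.1, w.2.1, w.2.2, l.1, l.2) := by
    rw [Fintype.sum_prod_type_right]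
    refine Finset.sum_congr rfl fun l _ => ?_
    rw [mulVec, dotProduct, Finset.mul_sum, Fintype.sum_prod_type, Fintype.sum_prod_type,
      Fintype.sum_prod_type]
    refine Finset.sum_congr rfl fun xh _ => ?_
    rw [Finset.sum_eq_single x]
    · refine Finset.sum_congr rfl fun br _ => ?_
      simp only [Source.sourceVec, finalMatrix, idealVec, of_apply, Pi.star_apply, star_mul',
        Pi.single_eq_same, star_one]
      ring
    · intro x' _ hx'
      simp [Source.sourceVec, hx']
    · simp
  rw [hsum]
  refine (norm_sq_sum_mul_le _ _).trans_eq ?_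
  have h1 : ∑ l : Fin L × Fin L, ‖star (maxEntangledVec L l)‖ ^ 2 = 1 := by
    simp only [norm_star]
    exact sum_norm_sq_maxEntangledVec hL
  rw [h1, one_mul]

lemma sum_norm_sq_finalMatrix [DecidableEq B] [DecidableEq CX] [DecidableEq CB]
    (hUX : UXᴴ * UX = 1) (hUB : UBᴴ * UB = 1) (hV : Vᴴ * V = 1) (hK : 0 < K) (x : Fin n → X) :
    ∑ i : (WX × WB × WD × Fin L × Fin L) × ((Fin n → X) × (Fin n → B) × (Fin n → R)),
      ‖finalMatrix s UX UB V x i.1 i.2‖ ^ 2 = 1 := by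
  rw [← sum_norm_sq_finalVec s UX UB V hUX hUB hV hK x]
  symm
  rw [Fintype.sum_prod_type, Fintype.sum_prod_type (γ := ℝ)
    (f := fun i => ‖finalMatrix s UX UB V x i.1 i.2‖ ^ 2)]
  congr 1
  funext w
  rw [Fintype.sum_prod_type]
  congr 1
  funext ⟨xh, bh, r⟩
  refine Finset.sum_eq_single x (fun x' _ hx' => ?_) (by simp)
  rw [finalVec_apply, if_neg hx', norm_zero, zero_pow two_ne_zero]

lemma condMutualInfo_finalState_le [DecidableEq B] [DecidableEq R] [DecidableEq CX]
    [DecidableEq CB] [DecidableEq WX] [DecidableEq WB] [DecidableEq WD]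
    (hn : 0 < n) (hK : 0 < K) (hL : 0 < L) {ε : ℝ} (hε : 0 ≤ ε) (hε' : 6 * ε ≤ 1)
    (code : EACode X B CX CB n K L) (hcode : 1 - ε ≤ code.avgFidelity s)
    (hUX : IsStinespring code.encX UX) (hUB : IsStinespring code.encB UB)
    (hV : IsStinespring code.dec V) :
    condMutualInfo (finalState s UX UB V) ≤
      n * delta (Fintype.card X) (Fintype.card B) n ε := by
  have hX : 0 < Fintype.card X := by
    by_contra hcon
    have : IsEmpty X := Fintype.card_eq_zero_iff.1 (by omega)
    simpa using s.p_sum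
  have hB : 0 < Fintype.card B := by
    by_contra hcon
    have : IsEmpty B := Fintype.card_eq_zero_iff.1 (by omega)
    obtain ⟨x⟩ := Fintype.card_pos_iff.1 hX
    simpa using s.ψ_norm x
  set D := Fintype.card X ^ n * (Fintype.card B ^ n * Fintype.card B ^ n) with hD
  set t := Real.sqrt (6 * ε) with ht
  have ht0 : 0 ≤ t := Real.sqrt_nonneg _
  have ht1 : t ≤ 1 := Real.sqrt_le_one.2 hε'
  have htsq : t ^ 2 = 6 * ε := Real.sq_sqrt (by linarith)
  let M := finalMatrix s UX UB V
  have hnorm := sum_norm_sq_finalMatrix s UX UB V hUX.1 hUB.1 hV.1 hK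
  have hI : condMutualInfo (finalState s UX UB V) =
      2 * ∑ x, s.pn n x * entropy ((M x)ᴴ * M x) := by
    rw [finalState_eq_sum_ketbra]
    refine condMutualInfo_classical_pure _ M hnorm ?_
    rintro x ⟨w, ⟨xh, bh, r⟩, x'⟩
    simp only [M, finalMatrix, of_apply, finalVec_apply, if_true]
  have hfid : 1 - t ≤ ∑ x, s.pn n x * (star (star (idealVec s x)) ⬝ᵥ
      ((M x)ᴴ * M x) *ᵥ star (idealVec s x)).re := by
    have h1 : ∀ x, s.pn n x * (2 * Real.sqrt (codeOverlap s UX UB V x) - 1) ≤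
        s.pn n x * (star (star (idealVec s x)) ⬝ᵥ
          ((M x)ᴴ * M x) *ᵥ star (idealVec s x)).re := by
      intro x
      refine mul_le_mul_of_nonneg_left (le_trans ?_ (codeOverlap_le s UX UB V hL x))
        (s.pn_nonneg n x)
      have h0 : 0 ≤ codeOverlap s UX UB V x := Finset.sum_nonneg fun _ _ => sq_nonneg _
      -- With `g` the overlap, `(√g - 1)² ≥ 0` gives `2√g - 1 ≤ g`, a bound linear in the fidelity
      -- after averaging.
      nlinarith [Real.sq_sqrt h0, sq_nonneg (Real.sqrt (codeOverlap s UX UB V x) - 1)]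
    have h2 := Finset.sum_le_sum fun x (_ : x ∈ Finset.univ) => h1 x
    have h3 : ∑ x, s.pn n x * (2 * Real.sqrt (codeOverlap s UX UB V x) - 1) =
        2 * code.avgFidelity s - 1 := by
      rw [avgFidelity_eq s UX UB V hL code hUX hUB hV, Finset.mul_sum]
      conv_rhs => rw [← s.sum_pn n]
      rw [← Finset.sum_sub_distrib]
      exact Finset.sum_congr rfl fun x _ => by ring
    -- The average overlap is at least `1 - 2ε`, and `2ε ≤ 6ε = t² ≤ t` since `0 ≤ t ≤ 1`.
    nlinarith
  have hS := sum_mul_entropy_le (s.pn_nonneg n) (s.sum_pn n)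
    (A := fun x => (M x)ᴴ * M x) (fun x => posSemidef_conjTranspose_mul_self _)
    (fun x => by rw [trace_mul_comm, trace_mul_conjTranspose_self, hnorm, Complex.ofReal_one])
    (D := D) (by positivity)
    (fun x => by rw [rank_conjTranspose_mul_self]; exact rank_finalMatrix_le s UX UB V x)
    (v := fun x => star (idealVec s x))
    (fun x => by simpa using sum_norm_sq_idealVec s x) ht0 ht1 hfid
  have hX' : (1 : ℝ) ≤ Fintype.card X := by exact_mod_cast hX
  have hB' : (1 : ℝ) ≤ Fintype.card B := by exact_mod_cast hB
  -- Exactly, `log D = n log|X| + 2n log|B|`; one further `n log|X| ≥ 0` is given away to reach the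
  -- stated form.
  have hlogD : Real.logb 2 D ≤
      2 * n * Real.logb 2 ((Fintype.card X : ℝ) * (Fintype.card B : ℝ)) := by
    rw [hD]
    push_cast
    rw [Real.logb_mul (by positivity) (by positivity),
      Real.logb_mul (by positivity) (by positivity), Real.logb_mul (by positivity) (by positivity),
      Real.logb_pow, Real.logb_pow]
    have := mul_nonneg (Nat.cast_nonneg (α := ℝ) n) (Real.logb_nonneg one_lt_two hX')
    linarith
  have hn' : (n : ℝ) ≠ 0 := by exact_mod_cast hn.ne'
  have hdelta : n * delta (Fintype.card X) (Fintype.card B) n ε =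
      4 * n * t * Real.logb 2 ((Fintype.card X : ℝ) * (Fintype.card B : ℝ)) +
        2 * binaryEntropy t := by
    rw [delta, ← ht]
    field_simp
  rw [hI, hdelta]
  nlinarith [mul_le_mul_of_nonneg_left hlogD ht0]

end Code

end

end CQSW

theorem mainTheorem10 {X B R CX CB WX WB WD : Type*}
    [Fintype X] [Fintype B] [Fintype R] [Fintype CX] [Fintype CB]
    [Fintype WX] [Fintype WB] [Fintype WD]
    [DecidableEq X] [DecidableEq B] [DecidableEq R] [DecidableEq CX] [DecidableEq CB]
    [DecidableEq WX] [DecidableEq WB] [DecidableEq WD]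
    (s : CQSW.Source X B R) (n K L : ℕ) (hn : 0 < n) (hK : 0 < K) (hL : 0 < L)
    (ε : ℝ) (hε : 0 ≤ ε) (hε' : 6 * ε ≤ 1)
    (code : CQSW.EACode X B CX CB n K L)
    (hcode : 1 - ε ≤ code.avgFidelity s)
    (UX : Matrix (CX × WX) (Fin n → X) ℂ) (hUX : CQSW.IsStinespring code.encX UX)
    (UB : Matrix ((CB × Fin L) × WB) ((Fin n → B) × Fin K) ℂ)
    (hUB : CQSW.IsStinespring code.encB UB)
    (V : Matrix ((((Fin n → X) × (Fin n → B)) × Fin L) × WD) ((CX × CB) × Fin K) ℂ)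
    (hV : CQSW.IsStinespring code.dec V) :
    CQSW.condMutualInfo (CQSW.finalState s UX UB V) ≤
      n * CQSW.delta (Fintype.card X) (Fintype.card B) n ε := by
  exact CQSW.condMutualInfo_finalState_le s UX UB V hn hK hL hε hε' code hcode hUX hUB hV
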